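/- Definitions. A partial flag $\mathcal F$ of $\mathbb R^n$ is a chain of subspaces $\mathbb R^n = V_0 \supsetneq V_1 \supsetneq \dots \supsetneq V_k \supsetneq V_{k+1} = 0$. A partial flag of quadratic forms $\beta = (\beta_0,\dots,\beta_k)$ on $\mathcal F$ consists of a nondegenerate quadratic form $\beta_i$ on $V_i/V_{i+1}$ for each $i$; its signature is $((p_0,q_0),\dots,(p_k,q_k))$, where $p_i$ (resp. $q_i$) is the largest dimension of a subspace on which $\beta_i$ is negative (resp. positive) definite. $\mathrm{Isom}(\mathcal F,\beta) \subset \mathrm{GL}_n(\mathbb R)$ is the group of linear automorphisms that preserve $\mathcal F$ and induce an isometry of every $\beta_i$, $\mathrm{P\,Isom}(\mathcal F,\beta)$ is its image in $\mathrm{PGL}_n(\mathbb R)$, and $X(\beta) = \{[x] \in \mathbb{RP}^{n-1} : \beta_0(x) < 0\}$. A subgeometry $(Z,L)$ of $(\mathbb{RP}^{n-1},\mathrm{PGL}_n(\mathbb R))$ is a closed subgroup $L$ together with a nonempty connected open set $Z$ that $L$ preserves and on which $L$ acts transitively. Subgroups $H_m$ converge geometrically to $L$ if every element of $L$ is the limit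 of some sequence $h_m \in H_m$ and every accumulation point of every sequence $h_m \in H_m$ lies in $L$. A subgeometry $(Z,L)$ is a conjugacy limit of $(Y,H)$ if there is a sequence $c_m \in \mathrm{PGL}_n(\mathbb R)$ such that $c_m H c_m^{-1}$ converges geometrically to $L$ and some $z \in Z$ lies in $c_m Y$ for all sufficiently large $m$. Theorem. Let $\beta$ be a partial flag of quadratic forms on a partial flag $\mathcal F = \{V_i\}$ of $\mathbb R^n$, with signature $((p_0,q_0),\dots,(p_k,q_k))$. (1) Every conjugacy limit of $(X(\beta), \mathrm{P\,Isom}(\mathcal F,\beta))$ is of the form $(X(\beta'), \mathrm{P\,Isom}(\mathcal F',\beta'))$ for a partial flag of quadratic forms $\beta'$ on some partial flag $\mathcal F'$ of $\mathbb R^n$. (2) Let $\beta'$ be a partial flag of quadratic forms on a partial flag $\mathcal F' = \{V'_j\}$ of $\mathbb R^n$, with signature $((p'_0,q'_0),\dots,(p'_{k'},q'_{k'}))$. Then $(X(\beta'), \mathrm{P\,Isom}(\mathcal F',\beta'))$ is a conjugacy limit of $(X(\beta), \mathrm{P\,Isom}(\mathcal F,\beta))$ if and only if $p'_0 > 0$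 and, up to conjugation, $\mathcal F'$ refines $\mathcal F$ and the signature of $\beta'$ refines that of $\beta$, in the following sense: there is $g \in \mathrm{GL}_n(\mathbb R)$ such that every $V_i$ is one of the subspaces $W_j = gV'_j$, and, after exchanging $(p'_j,q'_j)$ with $(q'_j,p'_j)$ for some collection of indices $j$ that does not contain $0$, $$p_i = \sum_{j:\, V_i \supseteq W_j \supsetneq V_{i+1}} p'_j, \qquad q_i = \sum_{j:\, V_i \supseteq W_j \supsetneq V_{i+1}} q'_j \qquad (0 \le i \le k).$$ -/

import Mathlib

open Filter Topology
open scoped Matrix MatrixGroups LinearAlgebra.Projectivization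

namespace PartialFlagGeometry

/-! ### Topologies on `PGL(n, ℝ)` and on real projective space -/

/-- `PGL(n, ℝ)` carries the quotient topology from `GL(n, ℝ)`. -/
instance pglTopology (n : ℕ) : TopologicalSpace (PGL(n, ℝ)) :=
  inferInstanceAs (TopologicalSpace (GL (Fin n) ℝ ⧸ Subgroup.center (GL (Fin n) ℝ)))

/-- Real projective space carries the quotient topology from the nonzero vectors. -/
noncomputable instance projTopology (n : ℕ) : TopologicalSpace (ℙ ℝ (Fin n → ℝ)) :=
  TopologicalSpace.coinduced (fun v : {v : Fin n → ℝ // v ≠ 0} => Projectivization.mk ℝ v.1 v.2)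
    inferInstance

/-! ### Limits of groups and of geometries -/

section Limits

variable {G X : Type*} [Group G] [TopologicalSpace G] [TopologicalSpace X] [MulAction G X]

/-- Geometric convergence of a sequence of subgroups: every element of `L` is the limit of
some sequence `h m ∈ H m`, and every accumulation point of every such sequence lies in `L`. -/
def ConvergesGeometrically (H : ℕ → Subgroup G) (L : Subgroup G) : Prop :=
  (∀ g ∈ L, ∃ h : ℕ → G, (∀ m, h m ∈ H m) ∧ Tendsto h atTop (𝓝 g)) ∧
  (∀ h : ℕ → G, (∀ m, h m ∈ H m) → ∀ g : G, MapClusterPt g atTop h → g ∈ L)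

/-- `(Z, L)` is a subgeometry of `(X, G)`: `L` is a closed subgroup of `G`, and `Z` is a
(nonempty) connected open subset of `X` that is preserved by `L` and on which `L` acts
transitively. -/
structure IsSubgeometry (Z : Set X) (L : Subgroup G) : Prop where
  isClosed : IsClosed (L : Set G)
  isOpen : IsOpen Z
  isConnected : IsConnected Z
  smul_mem : ∀ g ∈ L, ∀ z ∈ Z, g • z ∈ Z
  transitive : ∀ y ∈ Z, ∀ z ∈ Z, ∃ g ∈ L, g • y = z

/-- Convergence of a sequence of pairs `(Y m, H m)` to `(Z, L)`. -/
def SubgeometryConverges (Y : ℕ → Set X) (H : ℕ → Subgroup G) (Z : Set X) (L : Subgroup G) :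
    Prop :=
  ConvergesGeometrically H L ∧ ∃ z ∈ Z, ∀ᶠ m in atTop, z ∈ Y m

/-- The subgeometry `(Z, L)` is a conjugacy limit of `(Y, H)`: for some sequence `c m` in `G`
the conjugates `(c m • Y, c m * H * (c m)⁻¹)` converge to `(Z, L)`. -/
def IsConjugacyLimit (Y : Set X) (H : Subgroup G) (Z : Set X) (L : Subgroup G) : Prop :=
  IsSubgeometry Z L ∧ ∃ c : ℕ → G,
    SubgeometryConverges (fun m => (fun x => c m • x) '' Y)
      (fun m => H.map (MulAut.conj (c m)).toMonoidHom) Z L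

end Limits

/-! ### Partial flags of quadratic forms -/

/-- A partial flag `ℝⁿ = V 0 ⊋ V 1 ⊋ ⋯ ⊋ V k ⊋ V (k + 1) = 0`. -/
structure PartialFlag (n k : ℕ) where
  V : Fin (k + 2) → Submodule ℝ (Fin n → ℝ)
  strictAnti : StrictAnti V
  zero_eq : V 0 = ⊤
  last_eq : V (Fin.last (k + 1)) = ⊥

namespace PartialFlag

variable {n k : ℕ}

/-- The quotient `V i / V (i + 1)`, for `0 ≤ i ≤ k`. -/
abbrev Quot (F : PartialFlag n k) (i : Fin (k + 1)) : Type :=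
  F.V i.castSucc ⧸ (F.V i.succ).submoduleOf (F.V i.castSucc)

end PartialFlag

/-- A partial flag of (nondegenerate) quadratic forms on `F`: one on each `V i / V (i + 1)`. -/
structure FlagOfForms {n k : ℕ} (F : PartialFlag n k) where
  form : (i : Fin (k + 1)) → QuadraticForm ℝ (F.Quot i)
  nondegenerate : ∀ i, (form i).Nondegenerate

namespace FlagOfForms

variable {n k : ℕ} {F : PartialFlag n k}

/-- The form `β i` pulled back to `V i`. -/
def pullback (β : FlagOfForms F) (i : Fin (k + 1)) : QuadraticForm ℝ (F.V i.castSucc) :=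
  (β.form i).comp ((F.V i.succ).submoduleOf (F.V i.castSucc)).mkQ

/-- `p i`: the largest dimension of a subspace on which `β i` is negative definite. -/
noncomputable def p (β : FlagOfForms F) (i : Fin (k + 1)) : ℕ := sigNeg (β.form i)

/-- `q i`: the largest dimension of a subspace on which `β i` is positive definite. -/
noncomputable def q (β : FlagOfForms F) (i : Fin (k + 1)) : ℕ := sigPos (β.form i)

/-- `Isom(F, β)`: the linear automorphisms that preserve the flag `F` and induce an isometry
of every `β i`. -/
def isom (β : FlagOfForms F) : Subgroup (GL (Fin n) ℝ) where
  carrier := {g | (∀ i, (F.V i).map (Matrix.toLin' g.1) = F.V i) ∧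
    ∀ (i : Fin (k + 1)) (x y : F.V i.castSucc), (y : Fin n → ℝ) = g.1 *ᵥ (x : Fin n → ℝ) →
      β.pullback i y = β.pullback i x}
  one_mem' := by
    refine ⟨fun i => by simp, fun i x y h => ?_⟩
    have : y = x := Subtype.ext (by simpa using h)
    rw [this]
  mul_mem' := by
    rintro g h ⟨hg, hg'⟩ ⟨hh, hh'⟩
    refine ⟨fun i => ?_, fun i x y hy => ?_⟩
    · rw [Units.val_mul, Matrix.toLin'_mul, Submodule.map_comp, hh, hg]
    · have hz : h.1 *ᵥ (x : Fin n → ℝ) ∈ F.V i.castSucc := by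
        have hm := Submodule.mem_map_of_mem (f := Matrix.toLin' h.1) x.2
        rwa [hh i.castSucc, Matrix.toLin'_apply] at hm
      rw [hg' i ⟨_, hz⟩ y (by simpa [Matrix.mulVec_mulVec] using hy), hh' i x ⟨_, hz⟩ rfl]
  inv_mem' := by
    rintro g ⟨hg, hg'⟩
    refine ⟨fun i => ?_, fun i x y hy => ?_⟩
    · conv_lhs => rw [← hg i]
      rw [← Submodule.map_comp, ← Matrix.toLin'_mul, ← Units.val_mul]
      simp
    · refine (hg' i y x ?_).symm
      rw [hy, Matrix.mulVec_mulVec, ← Units.val_mul]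
      simp

/-- `P Isom(F, β)`: the image of `Isom(F, β)` in `PGL(n, ℝ)`. -/
def pIsom (β : FlagOfForms F) : Subgroup (PGL(n, ℝ)) :=
  β.isom.map Matrix.ProjGenLinGroup.mk

/-- `X(β)`: the set of all `[x]` in projective space with `β 0 (x) < 0`. -/
def domain (β : FlagOfForms F) : Set (ℙ ℝ (Fin n → ℝ)) :=
  {l | ∃ (x : F.V (0 : Fin (k + 1)).castSucc) (hx : (x : Fin n → ℝ) ≠ 0),
    l = Projectivization.mk ℝ (x : Fin n → ℝ) hx ∧ β.pullback 0 x < 0}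

end FlagOfForms

open scoped Classical in
/-- Up to conjugation, the flag `F'` is a refinement of `F` and the signature of `β'` is a
refinement of the signature of `β`: for some invertible `g` every subspace of `F` is one of the
subspaces `W j = g (V' j)`, and, after exchanging `(p' j, q' j)` with `(q' j, p' j)` for the
indices `j` of some set `S` that does not contain `0`, the pair `(p i, q i)` is the sum of the
`(p' j, q' j)` over all `j` with `V i ⊇ W j ⊋ V (i + 1)`. -/
def RefinesUpToConj {n k k' : ℕ} {F' : PartialFlag n k'} (β' : FlagOfForms F')
    {F : PartialFlag n k} (β : FlagOfForms F) : Prop :=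
  ∃ (g : GL (Fin n) ℝ) (W : Fin (k' + 2) → Submodule ℝ (Fin n → ℝ)) (S : Finset (Fin (k' + 1))),
    (∀ j, W j = (F'.V j).map (Matrix.toLin' g.1)) ∧
    (∀ i, ∃ j, W j = F.V i) ∧
    0 ∉ S ∧
    ∀ i : Fin (k + 1),
      β.p i = ∑ j : Fin (k' + 1) with W j.castSucc ≤ F.V i.castSucc ∧ F.V i.succ < W j.castSucc,
        (if j ∈ S then β'.q j else β'.p j) ∧
      β.q i = ∑ j : Fin (k' + 1) with W j.castSucc ≤ F.V i.castSucc ∧ F.V i.succ < W j.castSucc,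
        (if j ∈ S then β'.p j else β'.q j)

end PartialFlagGeometry

/-! Choose a frame: a basis `A`, a level `l j` for each basis vector and weights `w j`, such that
the flag consists of coordinate subspaces and each form is diagonal. The isometry group is then a
conjugate by `A` of the explicit matrix group `diagIsom l w`, and everything is read off from `(A,
l, w)`.

Compactness. Given a conjugating sequence `C m`, the Gram-Schmidt idea and the spectral theorem give
frames `A m` of the same `β` for which `C m * A m` is orthogonal (`exists_isFrame_orthogonal`).
Along an ultrafilter these orthogonal matrices converge to some `K`, and only the weights `w m` can
still diverge. Sorting the indices of each level by the growth rate of their weights splits it into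
finer levels `l'` with limiting weights `w'` (`exists_degenerates`).

Convergence of groups. If the weights degenerate in this way, the groups `diagIsom l (w m)` converge
to `diagIsom l' w'`. Limits stay in the limit group because adjointness passes to the limit
entrywise; every element is reached because, after multiplication by a matrix of signs, the Cayley
transform reduces the question to linear equations. Isometries have determinant `±1`, which lets the
statement descend to `PGL`. Hence every limit group is the projective isometry group of a finer flag
of forms. The limit point has nonpositive top form by continuity, and value zero is excluded because
an open orbit cannot lie in a quadric; so `Z` is the domain.

Classification. The group `diagIsom l w` determines the order of the levels and the weights up to a
factor on each level (`lt_of_diagIsom_le`, `mul_eq_mul_of_diagIsom_le`). Negative factors account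
for the exchanges of `p'` and `q'`; the domain rules them out on level `0`. Conversely, a refinement
is realized by rescaling the frame vectors so that the weights of level `j` are multiplied by the
`j`-th power of a sequence tending to zero (`degenerates_pow`). -/

namespace PartialFlagGeometry

set_option linter.unusedSectionVars false

/-! ### Filtered matrices and the matrix group of a diagonal flag of forms -/

section AdjointPairs

variable {ι α : Type*} [Fintype ι] [DecidableEq ι] [LinearOrder α]

/-- The matrices that preserve the filtration by the subspaces
`{x | ∀ j, l j < i → x j = 0}`. -/
def IsFiltered (l : ι → α) (P : Matrix ι ι ℝ) : Prop :=
  ∀ a b, l a < l b → P a b = 0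

/-- The block diagonal part of a matrix, for the blocks given by the level sets of `l`. -/
def diagPart (l : ι → α) (P : Matrix ι ι ℝ) : Matrix ι ι ℝ :=
  Matrix.of fun a b => if l a = l b then P a b else 0

/-- Filtered matrices whose diagonal blocks are adjoint for the diagonal form with weights `w`. -/
structure IsAdjointPair (l : ι → α) (w : ι → ℝ) (P Q : Matrix ι ι ℝ) : Prop where
  left : IsFiltered l P
  right : IsFiltered l Q
  adj : ∀ a b, l a = l b → w a * P a b = w b * Q b a

variable {l : ι → α} {w : ι → ℝ} {P Q P' Q' : Matrix ι ι ℝ}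

lemma isFiltered_iff : IsFiltered l P ↔ P.BlockTriangular (OrderDual.toDual ∘ l) :=
  ⟨fun h _ _ hab => h _ _ hab, fun h _ _ hab => h hab⟩

lemma IsFiltered.one : IsFiltered l (1 : Matrix ι ι ℝ) :=
  isFiltered_iff.2 Matrix.blockTriangular_one

lemma IsFiltered.add (hP : IsFiltered l P) (hQ : IsFiltered l Q) : IsFiltered l (P + Q) :=
  isFiltered_iff.2 ((isFiltered_iff.1 hP).add (isFiltered_iff.1 hQ))

lemma IsFiltered.neg (hP : IsFiltered l P) : IsFiltered l (-P) :=
  isFiltered_iff.2 (isFiltered_iff.1 hP).neg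

lemma IsFiltered.mul (hP : IsFiltered l P) (hQ : IsFiltered l Q) : IsFiltered l (P * Q) :=
  isFiltered_iff.2 ((isFiltered_iff.1 hP).mul (isFiltered_iff.1 hQ))

lemma IsFiltered.inv (hP : IsFiltered l P) (hu : IsUnit P) : IsFiltered l P⁻¹ := by
  have := hu.invertible
  exact isFiltered_iff.2 (Matrix.blockTriangular_inv_of_blockTriangular (isFiltered_iff.1 hP))

/-- For `a`, `b` in one level, the summand at `c` vanishes through `P` when `c` has a higher level
and through `Q` when it has a lower one. -/
lemma diagPart_mul (hP : IsFiltered l P) (hQ : IsFiltered l Q) :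
    diagPart l (P * Q) = diagPart l P * diagPart l Q := by
  ext a b
  simp only [diagPart, Matrix.of_apply, Matrix.mul_apply]
  by_cases hab : l a = l b
  · rw [if_pos hab]
    refine Finset.sum_congr rfl fun c _ => ?_
    rcases lt_trichotomy (l a) (l c) with h | h | h
    · simp [hP a c h, h.ne]
    · simp [h, ← hab]
    · simp [hQ c b (hab ▸ h), (hab ▸ h.ne : l c ≠ l b)]
  · rw [if_neg hab]
    refine (Finset.sum_eq_zero fun c _ => ?_).symm
    by_cases h : l a = l c
    · simp [h ▸ hab]
    · simp [h]

lemma diagPart_one : diagPart l (1 : Matrix ι ι ℝ) = 1 := by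
  ext a b
  by_cases h : a = b
  · subst h; simp [diagPart]
  · simp [diagPart, Matrix.one_apply_ne h]

lemma det_diagPart (hP : IsFiltered l P) : (diagPart l P).det = P.det := by
  have h : IsFiltered l (diagPart l P) := fun a b hab => by simp [diagPart, hab.ne]
  rw [(isFiltered_iff.1 hP).det, (isFiltered_iff.1 h).det]
  refine Finset.prod_congr rfl fun a _ => ?_
  congr 1
  ext ⟨x, hx⟩ ⟨y, hy⟩
  have : l x = l y := OrderDual.toDual.injective (hx.trans hy.symm)
  simp [diagPart, Matrix.toSquareBlock_def, this]

/-- As a single matrix identity, adjointness inherits closure under products and inverses from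
multiplicativity of `diagPart`. Working with pairs covers both the group (`Q = g⁻¹`) and its Lie
algebra (`Q = -X`). -/
lemma isAdjointPair_iff :
    IsAdjointPair l w P Q ↔ IsFiltered l P ∧ IsFiltered l Q ∧
      Matrix.diagonal w * diagPart l P = (diagPart l Q)ᵀ * Matrix.diagonal w := by
  refine ⟨fun h => ⟨h.left, h.right, ?_⟩, fun h => ⟨h.1, h.2.1, fun a b hab => ?_⟩⟩
  · ext a b
    by_cases hab : l a = l b
    · simpa [diagPart, hab, mul_comm] using h.adj a b hab
    · simp [diagPart, hab, Ne.symm hab]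
  · simpa [diagPart, hab, mul_comm] using congrFun (congrFun h.2.2 a) b

namespace IsAdjointPair

lemma symm (h : IsAdjointPair l w P Q) : IsAdjointPair l w Q P :=
  ⟨h.right, h.left, fun a b hab => (h.adj b a hab.symm).symm⟩

lemma one : IsAdjointPair l w (1 : Matrix ι ι ℝ) 1 :=
  isAdjointPair_iff.2 ⟨.one, .one, by simp [diagPart_one]⟩

lemma add (h : IsAdjointPair l w P Q) (h' : IsAdjointPair l w P' Q') :
    IsAdjointPair l w (P + P') (Q + Q') :=
  ⟨h.left.add h'.left, h.right.add h'.right, fun a b hab => by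
    simp [mul_add, h.adj a b hab, h'.adj a b hab]⟩

lemma neg (h : IsAdjointPair l w P Q) : IsAdjointPair l w (-P) (-Q) :=
  ⟨h.left.neg, h.right.neg, fun a b hab => by simp [h.adj a b hab]⟩

lemma mul (h : IsAdjointPair l w P Q) (h' : IsAdjointPair l w P' Q') :
    IsAdjointPair l w (P * P') (Q' * Q) := by
  rw [isAdjointPair_iff] at h h' ⊢
  refine ⟨h.1.mul h'.1, h'.2.1.mul h.2.1, ?_⟩
  rw [diagPart_mul h.1 h'.1, diagPart_mul h'.2.1 h.2.1, ← mul_assoc, h.2.2, mul_assoc, h'.2.2,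
    Matrix.transpose_mul, mul_assoc]

lemma inv (h : IsAdjointPair l w P Q) (hP : IsUnit P) (hQ : IsUnit Q) :
    IsAdjointPair l w P⁻¹ Q⁻¹ := by
  rw [isAdjointPair_iff] at h ⊢
  have hP' := h.1.inv hP
  have hQ' := h.2.1.inv hQ
  refine ⟨hP', hQ', ?_⟩
  have e₁ : diagPart l P * diagPart l P⁻¹ = 1 := by
    rw [← diagPart_mul h.1 hP', Matrix.mul_nonsing_inv _ ((Matrix.isUnit_iff_isUnit_det P).1 hP),
      diagPart_one]
  have e₂ : (diagPart l Q⁻¹)ᵀ * (diagPart l Q)ᵀ = 1 := by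
    rw [← Matrix.transpose_mul, ← diagPart_mul h.2.1 hQ',
      Matrix.mul_nonsing_inv _ ((Matrix.isUnit_iff_isUnit_det Q).1 hQ), diagPart_one,
      Matrix.transpose_one]
  calc Matrix.diagonal w * diagPart l P⁻¹
      = (diagPart l Q⁻¹)ᵀ * ((diagPart l Q)ᵀ * Matrix.diagonal w) * diagPart l P⁻¹ := by
        rw [← mul_assoc, e₂, one_mul]
    _ = (diagPart l Q⁻¹)ᵀ * Matrix.diagonal w := by
        rw [← h.2.2, mul_assoc, mul_assoc, e₁, mul_one]

/-- Determinants in the adjointness identity give `det g = det g⁻¹`, the weights cancelling. This is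
what later pins down a representative of a projective class up to sign. -/
lemma sq_det_eq_one (hw : ∀ a, w a ≠ 0) {g : GL ι ℝ} (h : IsAdjointPair l w g.1 g⁻¹.1) :
    g.1.det ^ 2 = 1 := by
  rw [isAdjointPair_iff] at h
  have e := congrArg Matrix.det h.2.2
  rw [Matrix.det_mul, Matrix.det_mul, Matrix.det_transpose, det_diagPart h.1,
    det_diagPart h.2.1, Matrix.det_diagonal, mul_comm] at e
  have e' := mul_right_cancel₀ (Finset.prod_ne_zero_iff.2 fun a _ => hw a) e
  have : g.1.det * g⁻¹.1.det = 1 := by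
    rw [← Matrix.det_mul, ← Units.val_mul, mul_inv_cancel, Units.val_one, Matrix.det_one]
  rw [← e'] at this
  rw [sq, this]

end IsAdjointPair

/-- The group of filtered matrices whose diagonal blocks are isometries of the diagonal form with
weights `w`. -/
def diagIsom (l : ι → α) (w : ι → ℝ) : Subgroup (GL ι ℝ) where
  carrier := {g | IsAdjointPair l w g.1 g⁻¹.1}
  one_mem' := by
    change IsAdjointPair l w (1 : GL ι ℝ).1 (1 : GL ι ℝ)⁻¹.1
    rw [inv_one]
    exact IsAdjointPair.one
  mul_mem' := fun {g h} hg hh => by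
    change IsAdjointPair l w (g * h).1 (g * h)⁻¹.1
    rw [mul_inv_rev]
    exact IsAdjointPair.mul hg hh
  inv_mem' := fun {g} hg => by
    change IsAdjointPair l w g⁻¹.1 g⁻¹⁻¹.1
    rw [inv_inv]
    exact IsAdjointPair.symm hg

lemma mem_diagIsom {g : GL ι ℝ} : g ∈ diagIsom l w ↔ IsAdjointPair l w g.1 g⁻¹.1 := Iff.rfl

/-- A diagonal matrix of signs. -/
def signMatrix (s : ι → ℤˣ) : GL ι ℝ :=
  ⟨Matrix.diagonal fun i => ((s i : ℤ) : ℝ), Matrix.diagonal fun i => ((s i : ℤ) : ℝ),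
    by simp [← Int.cast_mul, ← Units.val_mul], by simp [← Int.cast_mul, ← Units.val_mul]⟩

lemma val_signMatrix (s : ι → ℤˣ) :
    (signMatrix s).1 = Matrix.diagonal fun i => ((s i : ℤ) : ℝ) := rfl

lemma inv_signMatrix (s : ι → ℤˣ) : (signMatrix s)⁻¹ = signMatrix s := rfl

lemma signMatrix_mem (s : ι → ℤˣ) : signMatrix s ∈ diagIsom l w := by
  rw [mem_diagIsom, inv_signMatrix, val_signMatrix]
  refine ⟨fun a b h => ?_, fun a b h => ?_, fun a b h => ?_⟩
  · exact Matrix.diagonal_apply_ne _ fun e => h.ne (e ▸ rfl)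
  · exact Matrix.diagonal_apply_ne _ fun e => h.ne (e ▸ rfl)
  · by_cases hab : a = b
    · subst hab; simp
    · simp [hab, Ne.symm hab]

/-- Some diagonal matrix of signs moves a given matrix off the singular matrices. -/
lemma exists_signs_det_add_ne_zero (M : Matrix ι ι ℝ) :
    ∃ s : ι → ℤˣ, (M + (signMatrix s).1).det ≠ 0 := by
  -- Signs are chosen one row at a time; rows outside `t` are frozen to those of the identity.
  suffices H : ∀ (t : Finset ι) (M : Matrix ι ι ℝ), (∀ i ∉ t, ∀ j, M i j = (1 : Matrix ι ι ℝ) i j) →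
      ∃ d : ι → ℝ, (∀ i ∈ t, d i = 1 ∨ d i = -1) ∧ (∀ i ∉ t, d i = 0) ∧
        (M + Matrix.diagonal d).det ≠ 0 by
    obtain ⟨d, hd, -, h⟩ := H Finset.univ M (by simp)
    refine ⟨fun i => if d i = 1 then 1 else -1, ?_⟩
    have e : (fun i => (((if d i = 1 then 1 else -1 : ℤˣ) : ℤ) : ℝ)) = d := by
      funext i
      rcases hd i (Finset.mem_univ i) with h | h <;> rw [h] <;> norm_num
    rwa [val_signMatrix, e]
  intro t
  induction t using Finset.induction_on with
  | empty =>
    intro M hM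
    refine ⟨0, by simp, by simp, ?_⟩
    have : M = 1 := Matrix.ext fun i j => hM i (by simp) j
    simp [this]
  | insert a t ha ih =>
    intro M hM
    obtain ⟨d, hd, hd0, hdet⟩ := ih (M.updateRow a (Pi.single a 1)) fun i hi j => by
      by_cases h : i = a
      · subst h; simp [Matrix.one_apply, Pi.single_apply, eq_comm]
      · rw [Matrix.updateRow_ne h]; exact hM i (by simp [h, hi]) j
    have key : ∀ c : ℝ, M + Matrix.diagonal (Function.update d a c) =
        (M + Matrix.diagonal d).updateRow a (M a + c • Pi.single a 1) := by
      intro c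
      ext i j
      by_cases h : i = a
      · subst h
        by_cases hj : i = j
        · subst hj; simp
        · simp [hj, Ne.symm hj]
      · rw [Matrix.updateRow_ne h]
        by_cases hj : i = j
        · subst hj; simp [h]
        · simp [hj]
    have key' : (M.updateRow a (Pi.single a 1) + Matrix.diagonal d) =
        (M + Matrix.diagonal d).updateRow a (Pi.single a 1) := by
      ext i j
      by_cases h : i = a
      · subst h
        by_cases hj : i = j
        · subst hj; simp [hd0 i ha]
        · simp [hj]
      · simp [Matrix.updateRow_ne h]
    -- The determinant is affine in the new diagonal entry `c`, and its slope is nonzero by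
    -- induction, so it cannot vanish at both `c = 1` and `c = -1`.
    have hlin : ∀ c : ℝ, (M + Matrix.diagonal (Function.update d a c)).det =
        ((M + Matrix.diagonal d).updateRow a (M a)).det +
          c * (M.updateRow a (Pi.single a 1) + Matrix.diagonal d).det := by
      intro c
      rw [key, key', Matrix.det_updateRow_add, Matrix.det_updateRow_smul]
    have hcond : ∀ c : ℝ, (c = 1 ∨ c = -1) →
        (∀ i ∈ insert a t, Function.update d a c i = 1 ∨ Function.update d a c i = -1) ∧
        (∀ i ∉ insert a t, Function.update d a c i = 0) := by
      refine fun c hc => ⟨fun i hi => ?_, fun i hi => ?_⟩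
      · by_cases h : i = a
        · subst h; simpa using hc
        · simpa [h] using hd i (Finset.mem_of_mem_insert_of_ne hi h)
      · simp only [Finset.mem_insert, not_or] at hi
        simpa [hi.1] using hd0 i hi.2
    by_cases h1 : (M + Matrix.diagonal (Function.update d a 1)).det = 0
    · refine ⟨Function.update d a (-1), (hcond _ (.inr rfl)).1, (hcond _ (.inr rfl)).2, ?_⟩
      rw [hlin] at h1 ⊢
      intro h2
      apply hdet
      linarith
    · exact ⟨_, (hcond _ (.inl rfl)).1, (hcond _ (.inl rfl)).2, h1⟩

end AdjointPairs

end PartialFlagGeometry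

namespace PartialFlagGeometry

set_option linter.unusedSectionVars false

/-! ### Convergence of the matrix groups under degenerating weights -/

section Degeneration

variable {ι α α' κ : Type*} [Fintype ι] [DecidableEq ι] [LinearOrder α] [LinearOrder α']

/-- The diagonal forms with weights `w m` on the levels of `l` degenerate, along the filter `U`,
to the diagonal forms with weights `w'` on the levels of `l'`. -/
structure Degenerates (U : Filter κ) (l : ι → α) (w : κ → ι → ℝ) (l' : ι → α') (w' : ι → ℝ) :
    Prop where
  ne_zero : ∀ m a, w m a ≠ 0
  ne_zero' : ∀ a, w' a ≠ 0
  lt : ∀ a b, l a < l b → l' a < l' b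
  tendsto_zero : ∀ a b, l a = l b → l' a < l' b → Tendsto (fun m => w m b / w m a) U (𝓝 0)
  tendsto : ∀ a b, l' a = l' b → Tendsto (fun m => w m b / w m a) U (𝓝 (w' b / w' a))

variable {U : Filter κ} {l : ι → α} {w : κ → ι → ℝ} {l' : ι → α'} {w' : ι → ℝ}

lemma Degenerates.eq (h : Degenerates U l w l' w') {a b : ι} (hab : l' a = l' b) : l a = l b := by
  rcases lt_trichotomy (l a) (l b) with h' | h' | h'
  · exact absurd hab (h.lt a b h').ne
  · exact h'
  · exact absurd hab (h.lt b a h').ne'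

lemma tendsto_units_iff {g : κ → GL ι ℝ} {g₀ : GL ι ℝ} :
    Tendsto g U (𝓝 g₀) ↔
      Tendsto (fun m => (g m).1) U (𝓝 g₀.1) ∧ Tendsto (fun m => (g m)⁻¹.1) U (𝓝 g₀⁻¹.1) := by
  rw [Units.isInducing_embedProduct.tendsto_nhds_iff, Prod.tendsto_iff]
  refine and_congr Iff.rfl ?_
  rw [MulOpposite.opHomeomorph.symm.isInducing.tendsto_nhds_iff]
  rfl

lemma tendsto_matrix_iff {g : κ → Matrix ι ι ℝ} {g₀ : Matrix ι ι ℝ} :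
    Tendsto g U (𝓝 g₀) ↔ ∀ a b, Tendsto (fun m => g m a b) U (𝓝 (g₀ a b)) := by
  refine tendsto_pi_nhds.trans (forall_congr' fun a => ?_)
  exact tendsto_pi_nhds

/-- Limits of elements of degenerating isometry groups lie in the limit group. -/
lemma Degenerates.mem_of_tendsto [U.NeBot] (h : Degenerates U l w l' w') {g : κ → GL ι ℝ}
    {g₀ : GL ι ℝ} (hg : ∀ᶠ m in U, g m ∈ diagIsom l (w m)) (hlim : Tendsto g U (𝓝 g₀)) :
    g₀ ∈ diagIsom l' w' := by
  rw [tendsto_units_iff] at hlim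
  have key : ∀ (P Q : κ → Matrix ι ι ℝ) (P₀ Q₀ : Matrix ι ι ℝ), Tendsto P U (𝓝 P₀) →
      Tendsto Q U (𝓝 Q₀) → (∀ᶠ m in U, IsAdjointPair l (w m) (P m) (Q m)) →
      IsFiltered l' P₀ ∧ ∀ a b, l' a = l' b → w' a * P₀ a b = w' b * Q₀ b a := by
    intro P Q P₀ Q₀ hP hQ hPQ
    rw [tendsto_matrix_iff] at hP hQ
    -- Adjointness solved for `P m a b`. If `l' a < l' b` the weight ratio tends to `0`, so the
    -- entry dies and the limit is filtered for `l'`; if `l' a = l' b` the ratio tends to `w' b / w'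
    -- a`, which is adjointness for `w'`.
    have hadj : ∀ a b, l a = l b → ∀ᶠ m in U, P m a b = w m b / w m a * Q m b a := by
      intro a b hab
      filter_upwards [hPQ] with m hm
      have := hm.adj a b hab
      field_simp [h.ne_zero m a]
      linarith
    refine ⟨fun a b hab => ?_, fun a b hab => ?_⟩
    · rcases lt_trichotomy (l a) (l b) with hl | hl | hl
      · refine tendsto_nhds_unique_of_eventuallyEq (hP a b) tendsto_const_nhds ?_
        filter_upwards [hPQ] with m hm using hm.left a b hl
      · have := (h.tendsto_zero a b hl hab).mul (hQ b a)
        rw [zero_mul] at this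
        exact tendsto_nhds_unique_of_eventuallyEq (hP a b) this (hadj a b hl)
      · exact absurd (h.lt b a hl) hab.not_gt
    · have := tendsto_nhds_unique_of_eventuallyEq (hP a b)
        ((h.tendsto a b hab).mul (hQ b a)) (hadj a b (h.eq hab))
      have ha := h.ne_zero' a
      rw [this]
      field_simp
  have h₁ := key _ _ _ _ hlim.1 hlim.2 hg
  have h₂ := key _ _ _ _ hlim.2 hlim.1 (hg.mono fun m hm => hm.symm)
  exact ⟨h₁.1, h₂.1, h₁.2⟩

/-- Cayley transform of an element of the group. -/
lemma exists_cayley {w : ι → ℝ} {h : GL ι ℝ} (hh : h ∈ diagIsom l w) (hu : IsUnit (h.1 + 1)) :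
    ∃ X : Matrix ι ι ℝ, IsAdjointPair l w X (-X) ∧ IsUnit (1 - X) ∧ IsUnit (1 + X) ∧
      h.1 = (1 - X)⁻¹ * (1 + X) := by
  have hu' : IsUnit (h⁻¹.1 + 1) := by
    have : h⁻¹.1 + 1 = h⁻¹.1 * (h.1 + 1) := by
      rw [mul_add, mul_one, ← Units.val_mul, inv_mul_cancel, Units.val_one, add_comm]
    rw [this]
    exact (Units.isUnit _).mul hu
  have hd := (Matrix.isUnit_iff_isUnit_det _).1 hu
  have hd' := (Matrix.isUnit_iff_isUnit_det _).1 hu'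
  set Y := (h.1 + 1)⁻¹ with hY
  have hY1 : (h.1 + 1) * Y = 1 := Matrix.mul_nonsing_inv _ hd
  have hY2 : Y * (h.1 + 1) = 1 := Matrix.nonsing_inv_mul _ hd
  -- Here `X = (h - 1)(h + 1)⁻¹`. Its adjoint is the same expression in `h⁻¹` with the factors
  -- reversed, which simplifies to `-X`.
  have hadj : IsAdjointPair l w ((h.1 + -1) * Y) ((h⁻¹.1 + 1)⁻¹ * (h⁻¹.1 + -1)) :=
    (hh.add IsAdjointPair.one.neg).mul ((hh.add IsAdjointPair.one).inv hu hu')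
  have hinv : (h⁻¹.1 + 1)⁻¹ = Y * h.1 := by
    apply Matrix.inv_eq_left_inv
    rw [mul_assoc, mul_add, mul_one, ← Units.val_mul, mul_inv_cancel, Units.val_one,
      add_comm, hY2]
  have hcomm : Y * (h.1 + -1) = (h.1 + -1) * Y := by
    have : (h.1 + -1) = (h.1 + 1) - 2 := by rw [← one_add_one_eq_two]; abel
    rw [this, mul_sub, sub_mul, hY1, hY2, mul_two, two_mul]
  have hneg : (h⁻¹.1 + 1)⁻¹ * (h⁻¹.1 + -1) = -((h.1 + -1) * Y) := by
    rw [hinv, mul_assoc, mul_add, ← Units.val_mul, mul_inv_cancel, Units.val_one, ← hcomm,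
      ← mul_neg]
    congr 1
    rw [mul_neg, mul_one, neg_add, neg_neg, add_comm]
  rw [hneg] at hadj
  have e₁ : 1 - (h.1 + -1) * Y = (2 : ℝ) • Y := by
    have : (1 : Matrix ι ι ℝ) - (h.1 + -1) * Y = (h.1 + 1) * Y - (h.1 + -1) * Y := by rw [hY1]
    rw [this, ← sub_mul, two_smul, ← two_mul]
    congr 1
    rw [← one_add_one_eq_two]; abel
  have e₂ : 1 + (h.1 + -1) * Y = (2 : ℝ) • (h.1 * Y) := by
    have : (1 : Matrix ι ι ℝ) + (h.1 + -1) * Y = (h.1 + 1) * Y + (h.1 + -1) * Y := by rw [hY1]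
    rw [this, ← add_mul, two_smul, ← add_mul]
    congr 1
    abel
  have hYu : IsUnit Y := IsUnit.of_mul_eq_one _ hY2
  have u₁ : IsUnit ((2 : ℝ) • Y) := by
    exact hYu.smul (Units.mk0 (2 : ℝ) two_ne_zero)
  refine ⟨(h.1 + -1) * Y, hadj, e₁ ▸ u₁, ?_, ?_⟩
  · rw [e₂, ← mul_smul_comm]
    exact (Units.isUnit h).mul u₁
  · rw [e₁, e₂]
    have c : Y * h.1 = h.1 * Y := by
      have := hcomm
      rw [mul_add, add_mul, mul_neg, neg_mul, mul_one, one_mul] at this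
      exact add_right_cancel this
    rw [← c, ← smul_mul_assoc, Matrix.nonsing_inv_mul_cancel_left _ _
      ((Matrix.isUnit_iff_isUnit_det _).1 u₁)]

/-- Inverse Cayley transform. -/
lemma cayley_mem {w : ι → ℝ} {X : Matrix ι ι ℝ} (hX : IsAdjointPair l w X (-X))
    {g : GL ι ℝ} (hg : g.1 = (1 - X)⁻¹ * (1 + X)) (hg' : g⁻¹.1 = (1 + X)⁻¹ * (1 - X))
    (h₁ : IsUnit (1 - X)) (h₂ : IsUnit (1 + X)) :
    g ∈ diagIsom l w := by
  have a₁ : IsAdjointPair l w (1 - X) (1 + X) := by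
    have := IsAdjointPair.one.add hX.neg
    rwa [neg_neg, ← sub_eq_add_neg] at this
  have c : (1 + X)⁻¹ * (1 - X) = (1 - X) * (1 + X)⁻¹ := by
    have hd := (Matrix.isUnit_iff_isUnit_det _).1 h₂
    have : (1 - X) = 2 - (1 + X) := by rw [← one_add_one_eq_two]; abel
    rw [this, mul_sub, sub_mul, Matrix.mul_nonsing_inv _ hd, Matrix.nonsing_inv_mul _ hd, mul_two,
      two_mul]
  rw [mem_diagIsom, hg, hg', c]
  exact (a₁.inv h₁ h₂).mul a₁.symm

/-- Every element of the limit group is a limit of elements of the degenerating groups. -/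
lemma Degenerates.exists_tendsto (h : Degenerates U l w l' w') {g₀ : GL ι ℝ}
    (hg : g₀ ∈ diagIsom l' w') :
    ∃ g : κ → GL ι ℝ, (∀ m, g m ∈ diagIsom l (w m)) ∧ Tendsto g U (𝓝 g₀) := by
  classical
  let e := Fintype.equivFin ι
  -- The Cayley transform needs `-1` not to be an eigenvalue. Matrices of signs lie in `diagIsom l
  -- w` for all `l` and `w`, so `g₀` may be multiplied by one, and the factor restored at the end.
  obtain ⟨s, hs⟩ := exists_signs_det_add_ne_zero g₀.1
  set σ := signMatrix s
  have hσσ : σ * σ = 1 := by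
    have : σ⁻¹ = σ := inv_signMatrix s
    nth_rewrite 1 [← this]
    exact inv_mul_cancel _
  have hh : σ * g₀ ∈ diagIsom l' w' := mul_mem (signMatrix_mem s) hg
  have hu : IsUnit ((σ * g₀).1 + 1) := by
    have : (σ * g₀).1 + 1 = σ.1 * (g₀.1 + σ.1) := by
      rw [mul_add, ← Units.val_mul, ← Units.val_mul, hσσ, Units.val_one]
    rw [this]
    exact (Units.isUnit σ).mul ((Matrix.isUnit_iff_isUnit_det _).2 (isUnit_iff_ne_zero.2 hs))
  obtain ⟨X, hX, hX1, hX2, hXe⟩ := exists_cayley hh hu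
  -- Of two opposite entries within an `l`-level, keep the one that survives in the limit (the row
  -- of higher `l'`-level, with ties broken by the enumeration `e`); skew-adjointness for `w m`
  -- forces the other one.
  let Xm : κ → Matrix ι ι ℝ := fun m => Matrix.of fun a b =>
    if l' b < l' a ∨ (l' a = l' b ∧ e a ≤ e b) then X a b
    else if l a = l b then -(w m b / w m a * X b a) else 0
  have hdiag : ∀ a, X a a = 0 := by
    intro a
    have := hX.adj a a rfl
    rw [Matrix.neg_apply] at this
    have h' : w' a * X a a = 0 := by linarith
    exact (mul_eq_zero.1 h').resolve_left (h.ne_zero' a)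
  have hXm : ∀ m, IsAdjointPair l (w m) (Xm m) (-Xm m) := by
    intro m
    have hf : IsFiltered l (Xm m) := by
      intro a b hab
      have hab' := h.lt a b hab
      simp [Xm, hab'.not_gt, hab'.ne, hab.ne]
    refine ⟨hf, hf.neg, fun a b hab => ?_⟩
    have ha := h.ne_zero m a
    have hb := h.ne_zero m b
    simp only [Xm, Matrix.of_apply, Matrix.neg_apply, hab]
    rcases lt_trichotomy (l' a) (l' b) with hl | hl | hl
    · simp only [hl, hl.not_gt, hl.ne, hl.ne']
      simp only [true_or, false_and, or_self, if_true, if_false]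
      field_simp
    · rcases lt_trichotomy (e a) (e b) with hi | hi | hi
      · simp only [hl, hi.le, hi.not_ge, lt_irrefl]
        simp only [true_and, or_true, and_false, or_self, if_true, if_false]
        field_simp
      · cases e.injective hi; simp [hdiag]
      · simp only [hl, hi.le, hi.not_ge, lt_irrefl]
        simp only [true_and, or_true, and_false, or_self, if_true, if_false]
        field_simp
    · simp only [hl, hl.not_gt, hl.ne, hl.ne']
      simp only [true_or, false_and, or_self, if_true, if_false]
      field_simp
  have hXlim : Tendsto Xm U (𝓝 X) := by
    rw [tendsto_matrix_iff]
    intro a b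
    simp only [Xm, Matrix.of_apply]
    split_ifs with h1 h2
    · exact tendsto_const_nhds
    · push Not at h1
      rcases h1.1.lt_or_eq with h3 | h3
      · rw [hX.left a b h3]
        simpa using ((h.tendsto_zero a b h2 h3).mul_const (X b a)).neg
      · have := hX.adj a b h3
        rw [Matrix.neg_apply] at this
        have e : X a b = -(w' b / w' a * X b a) := by
          field_simp [h.ne_zero' a]
          linarith
        rw [e]
        exact ((h.tendsto a b h3).mul_const _).neg
    · push Not at h1
      rcases h1.1.lt_or_eq with h3 | h3
      · rw [hX.left a b h3]; exact tendsto_const_nhds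
      · exact absurd (h.eq h3) h2
  have hinv : ∀ {Y : κ → Matrix ι ι ℝ} {Y₀ : Matrix ι ι ℝ}, IsUnit Y₀ → Tendsto Y U (𝓝 Y₀) →
      Tendsto (fun m => (Y m)⁻¹) U (𝓝 Y₀⁻¹) ∧ ∀ᶠ m in U, IsUnit (Y m) := by
    intro Y Y₀ hY hlim
    have hd := (Matrix.isUnit_iff_isUnit_det _).1 hY
    refine ⟨?_, ?_⟩
    · refine (continuousAt_matrix_inv Y₀ ?_).tendsto.comp hlim
      have : (Ring.inverse : ℝ → ℝ) = Inv.inv := Ring.inverse_eq_inv'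
      rw [this]
      exact continuousAt_inv₀ hd.ne_zero
    · have : Tendsto (fun m => (Y m).det) U (𝓝 Y₀.det) :=
        (continuous_id.matrix_det.tendsto Y₀).comp hlim
      filter_upwards [this.eventually_ne hd.ne_zero] with m hm
      exact (Matrix.isUnit_iff_isUnit_det _).2 (isUnit_iff_ne_zero.2 hm)
  have l₁ : Tendsto (fun m => 1 - Xm m) U (𝓝 (1 - X)) := tendsto_const_nhds.sub hXlim
  have l₂ : Tendsto (fun m => 1 + Xm m) U (𝓝 (1 + X)) := tendsto_const_nhds.add hXlim
  obtain ⟨i₁, u₁⟩ := hinv hX1 l₁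
  obtain ⟨i₂, u₂⟩ := hinv hX2 l₂
  have hC : ∀ {A B : Matrix ι ι ℝ}, IsUnit A → IsUnit B → (A⁻¹ * B) * (B⁻¹ * A) = 1 := by
    intro A B hA hB
    rw [← mul_assoc, Matrix.mul_nonsing_inv_cancel_right _ _ ((Matrix.isUnit_iff_isUnit_det _).1 hB),
      Matrix.nonsing_inv_mul _ ((Matrix.isUnit_iff_isUnit_det _).1 hA)]
  let g : κ → GL ι ℝ := fun m => if hm : IsUnit (1 - Xm m) ∧ IsUnit (1 + Xm m) then
      σ * ⟨(1 - Xm m)⁻¹ * (1 + Xm m), (1 + Xm m)⁻¹ * (1 - Xm m), hC hm.1 hm.2, hC hm.2 hm.1⟩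
    else 1
  refine ⟨g, fun m => ?_, ?_⟩
  · by_cases hm : IsUnit (1 - Xm m) ∧ IsUnit (1 + Xm m)
    · simp only [g, dif_pos hm]
      exact mul_mem (signMatrix_mem s) (cayley_mem (hXm m) rfl rfl hm.1 hm.2)
    · simp only [g, dif_neg hm]
      exact one_mem _
  · have hinv₀ : (σ * g₀)⁻¹.1 = (1 + X)⁻¹ * (1 - X) := by
      rw [Matrix.coe_units_inv, hXe]
      exact Matrix.inv_eq_right_inv (hC hX1 hX2)
    have hg₀ : g₀ = σ * (σ * g₀) := by rw [← mul_assoc, hσσ, one_mul]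
    rw [hg₀]
    have hlim : Tendsto (fun m => σ⁻¹ * g m) U (𝓝 (σ * g₀)) := by
      rw [tendsto_units_iff]
      refine ⟨?_, ?_⟩
      · rw [hXe]
        refine (i₁.mul l₂).congr' ?_
        filter_upwards [u₁, u₂] with m h1 h2
        simp only [g, dif_pos (And.intro h1 h2), inv_mul_cancel_left]
      · rw [hinv₀]
        refine (i₂.mul l₁).congr' ?_
        filter_upwards [u₁, u₂] with m h1 h2
        simp only [g, dif_pos (And.intro h1 h2), inv_mul_cancel_left]
        rfl
    simpa using (tendsto_const_nhds (x := σ)).mul hlim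

end Degeneration

end PartialFlagGeometry

namespace PartialFlagGeometry

/-! ### Passage to the projective linear group -/

section Projective

variable {n : ℕ} {α α' κ : Type*} [LinearOrder α] [LinearOrder α']

/-- The isometry group of the diagonal forms with weights `w` in the frame given by `A`. -/
def frameIsom (A : GL (Fin n) ℝ) (l : Fin n → α) (w : Fin n → ℝ) : Subgroup (GL (Fin n) ℝ) :=
  (diagIsom l w).map (MulAut.conj A).toMonoidHom

lemma mem_frameIsom {A : GL (Fin n) ℝ} {l : Fin n → α} {w : Fin n → ℝ} {g : GL (Fin n) ℝ} :
    g ∈ frameIsom A l w ↔ A⁻¹ * g * A ∈ diagIsom l w := by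
  constructor
  · rintro ⟨h, hh, rfl⟩
    simpa [mul_assoc] using hh
  · exact fun h => ⟨_, h, by simp [mul_assoc]⟩

lemma neg_mem_diagIsom {l : Fin n → α} {w : Fin n → ℝ} {g : GL (Fin n) ℝ}
    (hg : g ∈ diagIsom l w) : -g ∈ diagIsom l w := by
  have : (-g)⁻¹ = -g⁻¹ := by rw [inv_neg]
  rw [mem_diagIsom, this, Units.val_neg, Units.val_neg]
  exact IsAdjointPair.neg hg

lemma neg_mem_frameIsom {A : GL (Fin n) ℝ} {l : Fin n → α} {w : Fin n → ℝ} {g : GL (Fin n) ℝ}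
    (hg : g ∈ frameIsom A l w) : -g ∈ frameIsom A l w := by
  rw [mem_frameIsom] at hg ⊢
  simpa using neg_mem_diagIsom hg

lemma sq_det_of_mem_frameIsom {A : GL (Fin n) ℝ} {l : Fin n → α} {w : Fin n → ℝ}
    (hw : ∀ a, w a ≠ 0) {g : GL (Fin n) ℝ} (hg : g ∈ frameIsom A l w) : g.1.det ^ 2 = 1 := by
  obtain ⟨h, hh, rfl⟩ := hg
  have := IsAdjointPair.sq_det_eq_one hw hh
  have e : (A * h * A⁻¹).1.det = h.1.det := by
    rw [Units.val_mul, Units.val_mul, Matrix.det_mul, Matrix.det_mul, mul_right_comm,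
      ← Matrix.det_mul, ← Units.val_mul, mul_inv_cancel, Units.val_one, Matrix.det_one, one_mul]
  change (A * h * A⁻¹).1.det ^ 2 = 1
  rwa [e]

/-- A matrix of determinant `±1` lies in the group as soon as its projective class does. -/
lemma mem_frameIsom_of_mk_mem (hn : n ≠ 0) {A : GL (Fin n) ℝ} {l : Fin n → α} {w : Fin n → ℝ}
    (hw : ∀ a, w a ≠ 0) {g : GL (Fin n) ℝ} (hdet : g.1.det ^ 2 = 1)
    (hg : Matrix.ProjGenLinGroup.mk g ∈ (frameIsom A l w).map Matrix.ProjGenLinGroup.mk) :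
    g ∈ frameIsom A l w := by
  obtain ⟨k, hk, hkg⟩ := hg
  obtain ⟨u, rfl⟩ := Matrix.ProjGenLinGroup.mk_eq_mk_iff.1 hkg
  have hk2 := sq_det_of_mem_frameIsom hw hk
  have hval : (k * Matrix.GeneralLinearGroup.scalar (Fin n) u).1 = u.1 • k.1 := by
    rw [Units.val_mul, Matrix.GeneralLinearGroup.coe_scalar, Matrix.scalar_apply,
      ← Matrix.smul_one_eq_diagonal, mul_smul_comm, mul_one]
  -- Both determinants square to `1` and scaling multiplies the determinant by `u ^ n`, so `(u ^ 2)
  -- ^ n = 1`. Hence `u = ±1`, and the group is stable under negation.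
  have hu : u.1 ^ 2 = 1 := by
    rw [hval, Matrix.det_smul, mul_pow, hk2, mul_one, Fintype.card_fin, ← pow_mul, mul_comm,
      pow_mul] at hdet
    exact (pow_eq_one_iff_of_nonneg (sq_nonneg _) hn).1 hdet
  rcases (by simpa using hu : u.1 = 1 ∨ u.1 = -1) with h | h
  · have : u = 1 := Units.ext h
    rwa [this, map_one, mul_one]
  · have : k * Matrix.GeneralLinearGroup.scalar (Fin n) u = -k := by
      refine Units.ext ?_
      rw [hval, h, Units.val_neg, neg_one_smul]
    rw [this]
    exact neg_mem_frameIsom hk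

lemma isOpenQuotientMap_mk :
    IsOpenQuotientMap (Matrix.ProjGenLinGroup.mk : GL (Fin n) ℝ → PGL(n, ℝ)) :=
  QuotientGroup.isOpenQuotientMap_mk (N := Subgroup.center (GL (Fin n) ℝ))

/-- The positive scalar `|det g| ^ (1 / n)`. -/
noncomputable def detRoot (g : GL (Fin n) ℝ) : ℝˣ :=
  Units.mk0 (|g.1.det| ^ (1 / n : ℝ)) (by
    have : g.1.det ≠ 0 := ((Matrix.isUnit_iff_isUnit_det _).1 g.isUnit).ne_zero
    positivity)

lemma continuous_detRoot : Continuous (detRoot : GL (Fin n) ℝ → ℝˣ) := by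
  refine Units.isEmbedding_val₀.continuous_iff.2 ?_
  refine Continuous.rpow_const ?_ fun _ => .inr (by positivity)
  exact (Units.continuous_val.matrix_det).abs

/-- The multiple of `g` of determinant `±1`. -/
noncomputable def normalize (g : GL (Fin n) ℝ) : GL (Fin n) ℝ :=
  g * Matrix.GeneralLinearGroup.scalar (Fin n) (detRoot g)⁻¹

lemma continuous_normalize : Continuous (normalize : GL (Fin n) ℝ → GL (Fin n) ℝ) := by
  refine continuous_id.mul (Continuous.comp ?_ continuous_detRoot.inv)
  exact Continuous.units_map _ (by
    change Continuous fun x : ℝ => Matrix.scalar (Fin n) x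
    simp only [Matrix.scalar_apply]
    exact Continuous.matrix_diagonal (by fun_prop))

lemma mk_normalize (g : GL (Fin n) ℝ) :
    Matrix.ProjGenLinGroup.mk (normalize g) = Matrix.ProjGenLinGroup.mk g := by
  rw [normalize, map_mul, Matrix.ProjGenLinGroup.mk_scalar, mul_one]

/-- By `mem_frameIsom_of_mk_mem`, the normalized lift of a projective isometry is therefore an
isometry, and it depends continuously on the lift. -/
lemma sq_det_normalize (hn : n ≠ 0) (g : GL (Fin n) ℝ) : (normalize g).1.det ^ 2 = 1 := by
  have h0 : g.1.det ≠ 0 := ((Matrix.isUnit_iff_isUnit_det _).1 g.isUnit).ne_zero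
  have h1 : ((detRoot g).1) ^ n = |g.1.det| := by
    rw [detRoot, Units.val_mk0, ← Real.rpow_natCast, ← Real.rpow_mul (abs_nonneg _),
      one_div_mul_cancel (by exact_mod_cast hn), Real.rpow_one]
  rw [normalize, Units.val_mul, Matrix.GeneralLinearGroup.coe_scalar, Matrix.scalar_apply,
    Matrix.det_mul, Matrix.det_diagonal, Finset.prod_const, Finset.card_univ, Fintype.card_fin,
    Units.val_inv_eq_inv_val, inv_pow, h1, mul_pow, inv_pow, sq_abs, mul_inv_cancel₀]
  positivity

variable {U : Filter κ} {l : Fin n → α} {w : κ → Fin n → ℝ} {l' : Fin n → α'} {w' : Fin n → ℝ}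
  {A : κ → GL (Fin n) ℝ} {A₀ : GL (Fin n) ℝ}

/-- Limits of projective isometries of degenerating forms are projective isometries of the
limit. -/
lemma Degenerates.mk_mem_of_tendsto [U.NeBot] (hn : n ≠ 0) (h : Degenerates U l w l' w')
    (hA : Tendsto A U (𝓝 A₀)) {g : κ → PGL(n, ℝ)} {g₀ : PGL(n, ℝ)}
    (hg : ∀ᶠ m in U, g m ∈ (frameIsom (A m) l (w m)).map Matrix.ProjGenLinGroup.mk)
    (hlim : Tendsto g U (𝓝 g₀)) :
    g₀ ∈ (frameIsom A₀ l' w').map Matrix.ProjGenLinGroup.mk := by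
  obtain ⟨γ, rfl⟩ := Matrix.ProjGenLinGroup.mk_surjective g₀
  let R : Set (κ × GL (Fin n) ℝ) := {p | Matrix.ProjGenLinGroup.mk p.2 = g p.1}
  -- Instead of choosing convergent lifts, pass to the filter of pairs (index, lift of `g m`) with
  -- the lift near `γ`. It is nontrivial because the quotient map is open.
  let V : Filter (κ × GL (Fin n) ℝ) := (U ×ˢ 𝓝 γ) ⊓ 𝓟 R
  have hV : V.NeBot := by
    rw [Filter.inf_principal_neBot_iff]
    intro S hS
    obtain ⟨s, hs, t, ht, hst⟩ := Filter.mem_prod_iff.1 hS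
    have h1 : ∀ᶠ m in U, g m ∈ Matrix.ProjGenLinGroup.mk '' t :=
      hlim (isOpenQuotientMap_mk.isOpenMap.image_mem_nhds ht)
    obtain ⟨m, ⟨x, hx, hxm⟩, hm⟩ := (h1.and hs).exists
    exact ⟨(m, x), hst ⟨hm, hx⟩, hxm⟩
  have hfst : Tendsto Prod.fst V U := tendsto_fst.mono_left inf_le_left
  have hsnd : Tendsto Prod.snd V (𝓝 γ) := tendsto_snd.mono_left inf_le_left
  have hR : ∀ᶠ p in V, p ∈ R := Filter.mem_inf_of_right (Filter.mem_principal_self R)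
  have hD : Degenerates V l (fun p => w p.1) l' w' :=
    ⟨fun p => h.ne_zero p.1, h.ne_zero', h.lt, fun a b h1 h2 => (h.tendsto_zero a b h1 h2).comp hfst,
      fun a b h1 => (h.tendsto a b h1).comp hfst⟩
  refine ⟨normalize γ, ?_, mk_normalize γ⟩
  rw [SetLike.mem_coe, mem_frameIsom]
  have hA' := hA.comp hfst
  refine hD.mem_of_tendsto (g := fun p => (A p.1)⁻¹ * normalize p.2 * A p.1) ?_
    ((hA'.inv.mul ((continuous_normalize.tendsto γ).comp hsnd)).mul hA')
  filter_upwards [hR, hfst.eventually hg] with p hp hgp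
  rw [← mem_frameIsom]
  refine mem_frameIsom_of_mk_mem hn (h.ne_zero p.1) (sq_det_normalize hn _) ?_
  rw [mk_normalize, hp]
  exact hgp

/-- Projective isometries of the limit are limits of projective isometries of degenerating
forms. -/
lemma Degenerates.exists_tendsto_mk (h : Degenerates U l w l' w')
    (hA : Tendsto A U (𝓝 A₀)) {g₀ : PGL(n, ℝ)}
    (hg : g₀ ∈ (frameIsom A₀ l' w').map Matrix.ProjGenLinGroup.mk) :
    ∃ g : κ → PGL(n, ℝ), (∀ m, g m ∈ (frameIsom (A m) l (w m)).map Matrix.ProjGenLinGroup.mk) ∧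
      Tendsto g U (𝓝 g₀) := by
  obtain ⟨γ, hγ, rfl⟩ := hg
  obtain ⟨g, hg, hlim⟩ := h.exists_tendsto (mem_frameIsom.1 hγ)
  refine ⟨fun m => Matrix.ProjGenLinGroup.mk (A m * g m * (A m)⁻¹), fun m =>
    ⟨_, mem_frameIsom.2 ?_, rfl⟩, ?_⟩
  · simpa [mul_assoc] using hg m
  · have := (hA.mul hlim).mul hA.inv
    simp only [mul_assoc, mul_inv_cancel_left, mul_inv_cancel, mul_one] at this
    simp only [mul_assoc]
    exact (isOpenQuotientMap_mk.continuous.tendsto γ).comp this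

/-- Geometric convergence to the limit group. -/
lemma Degenerates.convergesGeometrically (hn : n ≠ 0) {w : ℕ → Fin n → ℝ}
    (h : Degenerates atTop l w l' w') :
    ConvergesGeometrically
      (fun m => (frameIsom A₀ l (w m)).map Matrix.ProjGenLinGroup.mk)
      ((frameIsom A₀ l' w').map Matrix.ProjGenLinGroup.mk) := by
  refine ⟨fun g hg => h.exists_tendsto_mk tendsto_const_nhds hg, fun g hg g₀ hg₀ => ?_⟩
  obtain ⟨V, hV, hlim⟩ := mapClusterPt_iff_ultrafilter.1 hg₀
  have hD : Degenerates (V : Filter ℕ) l w l' w' :=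
    ⟨h.ne_zero, h.ne_zero', h.lt, fun a b h1 h2 => (h.tendsto_zero a b h1 h2).mono_left hV,
      fun a b h1 => (h.tendsto a b h1).mono_left hV⟩
  exact hD.mk_mem_of_tendsto hn (A := fun _ => A₀) tendsto_const_nhds
    (Eventually.of_forall fun m => hg m) hlim

/-- A geometric limit is determined by the convergence along any finer filter. -/
lemma ConvergesGeometrically.eq_map_frameIsom {H : ℕ → Subgroup (PGL(n, ℝ))}
    {L : Subgroup (PGL(n, ℝ))} (hL : ConvergesGeometrically H L) (hn : n ≠ 0) {U : Filter ℕ}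
    [U.NeBot] (hU : U ≤ atTop) {w : ℕ → Fin n → ℝ} {A : ℕ → GL (Fin n) ℝ}
    (h : Degenerates U l w l' w') (hA : Tendsto A U (𝓝 A₀))
    (hH : ∀ᶠ m in U, H m = (frameIsom (A m) l (w m)).map Matrix.ProjGenLinGroup.mk) :
    L = (frameIsom A₀ l' w').map Matrix.ProjGenLinGroup.mk := by
  classical
  ext g
  constructor
  · intro hg
    obtain ⟨x, hx, hlim⟩ := hL.1 g hg
    refine h.mk_mem_of_tendsto hn hA ?_ (hlim.mono_left hU)
    filter_upwards [hH] with m hm using hm ▸ hx m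
  · intro hg
    obtain ⟨x, hx, hlim⟩ := h.exists_tendsto_mk hA hg
    -- Membership of `x m` in `H m` is known only along `U`; replacing the other terms by `1` yields
    -- a genuine sequence, and `g` remains an accumulation point of it.
    refine hL.2 (fun m => if x m ∈ H m then x m else 1) (fun m => ?_) g ?_
    · by_cases hm : x m ∈ H m
      · simp [hm]
      · simp [hm, one_mem]
    · have : Tendsto (fun m => if x m ∈ H m then x m else 1) U (𝓝 g) := by
        refine hlim.congr' ?_
        filter_upwards [hH] with m hm
        rw [if_pos (hm ▸ hx m)]
      exact this.mapClusterPt.mono hU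

/-- The projective isometry group is closed. -/
lemma isClosed_map_frameIsom (hn : n ≠ 0) {w : Fin n → ℝ} (hw : ∀ a, w a ≠ 0) :
    IsClosed (((frameIsom A₀ l w).map Matrix.ProjGenLinGroup.mk : Subgroup (PGL(n, ℝ))) :
      Set (PGL(n, ℝ))) := by
  refine isClosed_iff_clusterPt.2 fun g hg => ?_
  rw [← mem_closure_iff_clusterPt, mem_closure_iff_nhdsWithin_neBot] at hg
  have : (𝓝[{x | x ∈ (frameIsom A₀ l w).map Matrix.ProjGenLinGroup.mk}] g).NeBot := hg
  -- Closedness is the case of constant weights, with the group elements near `g` themselves as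
  -- indices.
  refine Degenerates.mk_mem_of_tendsto (A := fun _ => A₀) (g := id) (w := fun _ => w)
    (U := 𝓝[{x | x ∈ (frameIsom A₀ l w).map Matrix.ProjGenLinGroup.mk}] g) hn
    ⟨fun _ => hw, hw, fun _ _ h => h, fun a b h h' => absurd h h'.ne,
      fun _ _ _ => tendsto_const_nhds⟩ tendsto_const_nhds self_mem_nhdsWithin
    (tendsto_id.mono_left nhdsWithin_le_nhds)

end Projective

end PartialFlagGeometry

namespace PartialFlagGeometry

/-! ### Frames of a flag of forms and the isometry group -/

section Frames

variable {n k : ℕ}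

/-- The flag `F` consists of coordinate subspaces in the frame given by `A`. -/
def IsFlagFrame (F : PartialFlag n k) (A : GL (Fin n) ℝ) (l : Fin n → Fin (k + 1)) : Prop :=
  ∀ i x, A.1 *ᵥ x ∈ F.V i ↔ ∀ j, (l j).castSucc < i → x j = 0

/-- In the frame given by `A` the flag consists of coordinate subspaces and the forms are
diagonal with weights `w`. -/
structure IsFrame {F : PartialFlag n k} (β : FlagOfForms F) (A : GL (Fin n) ℝ)
    (l : Fin n → Fin (k + 1)) (w : Fin n → ℝ) : Prop where
  flag : IsFlagFrame F A l
  pullback : ∀ i x (h : A.1 *ᵥ x ∈ F.V i.castSucc),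
    β.pullback i ⟨A.1 *ᵥ x, h⟩ = ∑ j with l j = i, w j * x j ^ 2

variable {F : PartialFlag n k} {β : FlagOfForms F} {A : GL (Fin n) ℝ} {l : Fin n → Fin (k + 1)}
  {w : Fin n → ℝ}

lemma inv_mulVec_mulVec (A : GL (Fin n) ℝ) (x : Fin n → ℝ) : A⁻¹.1 *ᵥ (A.1 *ᵥ x) = x := by
  rw [Matrix.mulVec_mulVec, ← Units.val_mul, inv_mul_cancel, Units.val_one, Matrix.one_mulVec]

lemma mulVec_inv_mulVec (A : GL (Fin n) ℝ) (x : Fin n → ℝ) : A.1 *ᵥ (A⁻¹.1 *ᵥ x) = x := by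
  rw [Matrix.mulVec_mulVec, ← Units.val_mul, mul_inv_cancel, Units.val_one, Matrix.one_mulVec]

lemma IsFlagFrame.mem_iff' (h : IsFlagFrame F A l) (i : Fin (k + 2)) (v : Fin n → ℝ) :
    v ∈ F.V i ↔ ∀ j, (l j).castSucc < i → (A⁻¹.1 *ᵥ v) j = 0 := by
  rw [← h, mulVec_inv_mulVec]

/-- A vector of `V i` outside `V (i + 1)` has a nonzero coordinate of level at most `i`, and those
of level below `i` vanish. -/
lemma IsFlagFrame.surjective (h : IsFlagFrame F A l) : Function.Surjective l := by
  intro i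
  obtain ⟨v, hv, hv'⟩ := SetLike.exists_of_lt (F.strictAnti (Fin.castSucc_lt_succ (i := i)))
  rw [h.mem_iff'] at hv hv'
  push Not at hv'
  obtain ⟨j, hj, hj'⟩ := hv'
  refine ⟨j, le_antisymm (Fin.castSucc_lt_succ_iff.1 hj) ?_⟩
  by_contra hlt
  exact hj' (hv j (Fin.castSucc_lt_castSucc_iff.2 (not_le.1 hlt)))

/-- On `V i`, the projection to the coordinates of level `i` is surjective with kernel `V (i + 1)`.
-/
lemma IsFlagFrame.exists_quotEquiv (h : IsFlagFrame F A l) (i : Fin (k + 1)) :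
    ∃ e : F.Quot i ≃ₗ[ℝ] ({j // l j = i} → ℝ), ∀ (v : F.V i.castSucc) (j : {j // l j = i}),
      e (Submodule.Quotient.mk v) j = (A⁻¹.1 *ᵥ (v : Fin n → ℝ)) j := by
  let f : F.V i.castSucc →ₗ[ℝ] ({j // l j = i} → ℝ) :=
    (LinearMap.funLeft ℝ ℝ (Subtype.val : {j // l j = i} → Fin n)) ∘ₗ
      (Matrix.toLin' A⁻¹.1) ∘ₗ (F.V i.castSucc).subtype
  have hf : ∀ (v : F.V i.castSucc) (j : {j // l j = i}), f v j = (A⁻¹.1 *ᵥ (v : Fin n → ℝ)) j :=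
    fun v j => rfl
  have hker : (F.V i.succ).submoduleOf (F.V i.castSucc) = LinearMap.ker f := by
    ext v
    rw [LinearMap.mem_ker]
    change (v : Fin n → ℝ) ∈ F.V i.succ ↔ _
    rw [h.mem_iff']
    constructor
    · intro hv
      funext j
      rw [hf]
      exact hv j (by rw [j.2]; exact Fin.castSucc_lt_succ)
    · intro hv j hj
      rcases (Fin.castSucc_lt_succ_iff.1 hj).lt_or_eq with hlt | heq
      · exact (h.mem_iff' _ _).1 v.2 j (Fin.castSucc_lt_castSucc_iff.2 hlt)
      · exact congrFun hv ⟨j, heq⟩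
  have hsurj : Function.Surjective f := by
    intro y
    let x : Fin n → ℝ := fun j => if hj : l j = i then y ⟨j, hj⟩ else 0
    have hx : A.1 *ᵥ x ∈ F.V i.castSucc := by
      rw [h]
      intro j hj
      exact dif_neg (Fin.castSucc_lt_castSucc_iff.1 hj).ne
    refine ⟨⟨_, hx⟩, ?_⟩
    funext j
    rw [hf]
    change (A⁻¹.1 *ᵥ (A.1 *ᵥ x)) j = y j
    rw [inv_mulVec_mulVec]
    exact dif_pos j.2
  exact ⟨(Submodule.quotEquivOfEq _ _ hker).trans (f.quotKerEquivOfSurjective hsurj),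
    fun v j => rfl⟩

lemma IsFrame.equivalent (h : IsFrame β A l w) (i : Fin (k + 1)) :
    (β.form i).Equivalent
      (QuadraticMap.weightedSumSquares ℝ fun j : {j // l j = i} => w j) := by
  obtain ⟨e, he⟩ := h.flag.exists_quotEquiv i
  refine ⟨⟨e, fun q => ?_⟩⟩
  obtain ⟨v, rfl⟩ := Submodule.Quotient.mk_surjective _ q
  have hv : A.1 *ᵥ (A⁻¹.1 *ᵥ (v : Fin n → ℝ)) ∈ F.V i.castSucc := by
    rw [mulVec_inv_mulVec]; exact v.2
  have e1 : β.form i (Submodule.Quotient.mk v) = β.pullback i ⟨_, hv⟩ := by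
    simp only [mulVec_inv_mulVec]
    rfl
  rw [e1, h.pullback]
  change QuadraticMap.weightedSumSquares ℝ (fun j : {j // l j = i} => w j)
    (e (Submodule.Quotient.mk v)) = _
  rw [QuadraticMap.weightedSumSquares_apply,
    Finset.sum_subtype (p := fun j => l j = i) _ (by simp)]
  exact Finset.sum_congr rfl fun j _ => by rw [he, smul_eq_mul, sq]

/-- The zero weights of a level count the dimension of the radical of its form. -/
lemma IsFrame.ne_zero (h : IsFrame β A l w) (j : Fin n) : w j ≠ 0 := by
  intro hj
  have h1 := QuadraticForm.finrank_radical_of_equiv_weightedSumSquares (h.equivalent (l j))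
  rw [(β.nondegenerate (l j)).radical_eq_bot, finrank_bot, eq_comm,
    Set.ncard_eq_zero (Set.toFinite _)] at h1
  exact Set.notMem_empty (⟨j, rfl⟩ : {j' // l j' = l j}) (h1 ▸ hj)

lemma ncard_subtype_eq (i : Fin (k + 1)) (P : ℝ → Prop) [DecidablePred P] :
    {j : {j // l j = i} | P (w j)}.ncard =
      (Finset.univ.filter fun j => l j = i ∧ P (w j)).card := by
  rw [← Set.ncard_image_of_injective _ Subtype.val_injective, ← Set.ncard_coe_finset]
  congr 1
  ext j
  simp [and_comm]

lemma IsFrame.p_eq (h : IsFrame β A l w) (i : Fin (k + 1)) :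
    β.p i = (Finset.univ.filter fun j => l j = i ∧ w j < 0).card := by
  rw [← ncard_subtype_eq i (· < 0)]
  exact QuadraticForm.sigNeg_of_equiv_weightedSumSquares (h.equivalent i)

lemma IsFrame.q_eq (h : IsFrame β A l w) (i : Fin (k + 1)) :
    β.q i = (Finset.univ.filter fun j => l j = i ∧ 0 < w j).card := by
  rw [← ncard_subtype_eq i (0 < ·)]
  exact QuadraticForm.sigPos_of_equiv_weightedSumSquares (h.equivalent i)

lemma IsFiltered.mulVec_eq_zero {P : Matrix (Fin n) (Fin n) ℝ} (hP : IsFiltered l P)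
    {i : Fin (k + 2)} {x : Fin n → ℝ} (hx : ∀ j, (l j).castSucc < i → x j = 0) (j : Fin n)
    (hj : (l j).castSucc < i) : (P *ᵥ x) j = 0 := by
  rw [Matrix.mulVec, dotProduct]
  refine Finset.sum_eq_zero fun c _ => ?_
  by_cases hc : (l c).castSucc < i
  · rw [hx c hc, mul_zero]
  · rw [hP j c (Fin.castSucc_lt_castSucc_iff.1 (hj.trans_le (not_lt.1 hc))), zero_mul]

lemma IsFiltered.mulVec_eq_sum {P : Matrix (Fin n) (Fin n) ℝ} (hP : IsFiltered l P)
    {i : Fin (k + 1)} {x : Fin n → ℝ} (hx : ∀ j, l j < i → x j = 0) {a : Fin n}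
    (ha : l a = i) : (P *ᵥ x) a = ∑ c with l c = i, P a c * x c := by
  rw [Finset.sum_filter, Matrix.mulVec, dotProduct]
  refine Finset.sum_congr rfl fun c _ => ?_
  rcases lt_trichotomy (l c) i with hc | hc | hc
  · simp [hx c hc]
  · simp [hc]
  · simp [hP a c (ha ▸ hc)]

/-- Write one factor of `y a ^ 2` as `(g x) a` and move `g` across the form as `g⁻¹`; then `g⁻¹ y =
x` restores the sum. -/
lemma IsAdjointPair.sum_mulVec_sq {g : GL (Fin n) ℝ} (hg : g ∈ diagIsom l w) {i : Fin (k + 1)}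
    {x : Fin n → ℝ} (hx : ∀ j, l j < i → x j = 0) :
    ∑ j with l j = i, w j * (g.1 *ᵥ x) j ^ 2 = ∑ j with l j = i, w j * x j ^ 2 := by
  set y := g.1 *ᵥ x with hy
  have hxy : x = g⁻¹.1 *ᵥ y := by rw [hy, inv_mulVec_mulVec]
  have hy0 : ∀ j, l j < i → y j = 0 := fun j hj =>
    hg.left.mulVec_eq_zero (i := i.castSucc)
      (fun j hj => hx j (Fin.castSucc_lt_castSucc_iff.1 hj)) j (Fin.castSucc_lt_castSucc_iff.2 hj)
  calc ∑ a with l a = i, w a * y a ^ 2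
      = ∑ a with l a = i, ∑ c with l c = i, w c * x c * (g⁻¹.1 c a * y a) := by
        refine Finset.sum_congr rfl fun a ha => ?_
        have ha' := (Finset.mem_filter.1 ha).2
        have e : y a = ∑ c with l c = i, g.1 a c * x c := hg.left.mulVec_eq_sum hx ha'
        rw [sq]
        nth_rewrite 1 [e]
        rw [Finset.sum_mul, Finset.mul_sum]
        refine Finset.sum_congr rfl fun c hc => ?_
        have := hg.adj a c (ha'.trans (Finset.mem_filter.1 hc).2.symm)
        linear_combination (x c * y a) * this
    _ = ∑ c with l c = i, w c * x c ^ 2 := by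
        rw [Finset.sum_comm]
        refine Finset.sum_congr rfl fun c hc => ?_
        rw [← Finset.mul_sum, ← hg.right.mulVec_eq_sum hy0 (Finset.mem_filter.1 hc).2, ← hxy]
        ring

/-- The isometry group in terms of a frame. -/
lemma IsFrame.isom_eq (h : IsFrame β A l w) : β.isom = frameIsom A l w := by
  have hconj : ∀ (g : GL (Fin n) ℝ) (x : Fin n → ℝ),
      A.1 *ᵥ ((A⁻¹ * g * A).1 *ᵥ x) = g.1 *ᵥ (A.1 *ᵥ x) := by
    intro g x
    rw [Matrix.mulVec_mulVec, Matrix.mulVec_mulVec, ← Units.val_mul, ← Units.val_mul]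
    simp [mul_assoc]
  ext g
  rw [mem_frameIsom]
  constructor
  · intro hg
    have hmem : ∀ g ∈ β.isom, ∀ i x, A.1 *ᵥ x ∈ F.V i → A.1 *ᵥ ((A⁻¹ * g * A).1 *ᵥ x) ∈ F.V i := by
      intro g hg i x hx
      rw [hconj, ← hg.1 i]
      exact ⟨_, hx, rfl⟩
    have hcol : ∀ b, ∀ i, i ≤ (l b).castSucc → A.1 *ᵥ Pi.single b 1 ∈ F.V i := by
      intro b i hi
      rw [h.flag]
      intro j hj
      exact Pi.single_eq_of_ne (fun e => (hj.trans_le hi).ne (congrArg (fun c => (l c).castSucc) e)) _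
    have hfil : ∀ g ∈ β.isom, IsFiltered l (A⁻¹ * g * A).1 := by
      intro g hg a b hab
      have := (h.flag _ _).1 (hmem g hg _ _ (hcol b _ le_rfl)) a
        (Fin.castSucc_lt_castSucc_iff.2 hab)
      rwa [Matrix.mulVec_single_one] at this
    have einv : (A⁻¹ * g * A)⁻¹ = A⁻¹ * g⁻¹ * A := by group
    rw [mem_diagIsom]
    refine ⟨hfil g hg, einv ▸ hfil _ (inv_mem hg), fun a b hab => ?_⟩
    have hq : ∀ x, A.1 *ᵥ x ∈ F.V (l b).castSucc →
        ∑ j with l j = l b, w j * ((A⁻¹ * g * A).1 *ᵥ x) j ^ 2 =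
          ∑ j with l j = l b, w j * x j ^ 2 := by
      intro x hx
      rw [← h.pullback _ _ hx, ← h.pullback _ _ (hmem g hg _ _ hx)]
      exact hg.2 _ _ _ (hconj g x)
    -- Polarize invariance at `y = g⁻¹ e_a` and `e_b`, in frame coordinates: pairing `g y = e_a`
    -- with `g e_b` gives `w a * g a b`, and pairing `y` with `e_b` gives `w b * g⁻¹ b a`.
    set y := (A⁻¹ * g⁻¹ * A).1 *ᵥ Pi.single a 1 with hy
    have hgy : (A⁻¹ * g * A).1 *ᵥ y = Pi.single a 1 := by
      rw [hy, ← einv, mulVec_inv_mulVec]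
    have hyV : A.1 *ᵥ y ∈ F.V (l b).castSucc :=
      hmem _ (inv_mem hg) _ _ (hcol a _ (by rw [hab]))
    have hbV : A.1 *ᵥ Pi.single b 1 ∈ F.V (l b).castSucc := hcol b _ le_rfl
    have h1 := hq _ hyV
    have h2 := hq _ hbV
    have h3 := hq (y + Pi.single b 1) (by rw [Matrix.mulVec_add]; exact add_mem hyV hbV)
    rw [Matrix.mulVec_add, hgy] at h3
    rw [hgy] at h1
    have expand : ∀ u v : Fin n → ℝ, ∑ j with l j = l b, w j * (u + v) j ^ 2 =
        ∑ j with l j = l b, w j * u j ^ 2 + ∑ j with l j = l b, w j * v j ^ 2 +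
          2 * ∑ j with l j = l b, w j * (u j * v j) := by
      intro u v
      rw [Finset.mul_sum, ← Finset.sum_add_distrib, ← Finset.sum_add_distrib]
      exact Finset.sum_congr rfl fun j _ => by rw [Pi.add_apply]; ring
    rw [expand, expand, h1, h2] at h3
    have h4 : ∑ j with l j = l b, w j * ((Pi.single a 1 : Fin n → ℝ) j *
        ((A⁻¹ * g * A).1 *ᵥ Pi.single b 1) j) = ∑ j with l j = l b,
          w j * (y j * (Pi.single b 1 : Fin n → ℝ) j) := by linarith
    rw [Finset.sum_eq_single a (fun c _ hc => by simp [hc]) (fun ha => by simp [hab] at ha),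
      Finset.sum_eq_single b (fun c _ hc => by simp [hc]) (fun ha => by simp at ha)] at h4
    simp only [Pi.single_eq_same, one_mul, mul_one, Matrix.mulVec_single_one, hy] at h4
    rw [einv]
    exact h4
  · intro hg
    have hle : ∀ g : GL (Fin n) ℝ, IsFiltered l (A⁻¹ * g * A).1 → ∀ i v, v ∈ F.V i →
        g.1 *ᵥ v ∈ F.V i := by
      intro g hg i v hv
      have := hconj g (A⁻¹.1 *ᵥ v)
      rw [mulVec_inv_mulVec] at this
      rw [← this, h.flag]
      exact fun j hj => hg.mulVec_eq_zero ((h.flag.mem_iff' i v).1 hv) j hj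
    have einv : (A⁻¹ * g * A)⁻¹ = A⁻¹ * g⁻¹ * A := by group
    refine ⟨fun i => le_antisymm ?_ fun v hv => ?_, fun i x y hy => ?_⟩
    · rintro _ ⟨v, hv, rfl⟩
      exact hle g hg.left i v hv
    · exact ⟨_, hle g⁻¹ (einv ▸ hg.right) i v hv, by
        rw [Matrix.toLin'_apply, mulVec_inv_mulVec]⟩
    · have hx := x.2
      rw [h.flag.mem_iff'] at hx
      have ex : x = ⟨A.1 *ᵥ (A⁻¹.1 *ᵥ x.1), by rw [mulVec_inv_mulVec]; exact x.2⟩ :=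
        Subtype.ext (mulVec_inv_mulVec A _).symm
      have ey : (y : Fin n → ℝ) = A.1 *ᵥ ((A⁻¹ * g * A).1 *ᵥ (A⁻¹.1 *ᵥ x.1)) := by
        rw [hconj, mulVec_inv_mulVec, hy]
      have ey' : y = ⟨A.1 *ᵥ ((A⁻¹ * g * A).1 *ᵥ (A⁻¹.1 *ᵥ x.1)), ey ▸ y.2⟩ := Subtype.ext ey
      rw [ex, ey', h.pullback, h.pullback]
      exact IsAdjointPair.sum_mulVec_sq hg
        fun j hj => hx j (Fin.castSucc_lt_castSucc_iff.2 hj)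

lemma IsFrame.pIsom_eq (h : IsFrame β A l w) :
    β.pIsom = (frameIsom A l w).map Matrix.ProjGenLinGroup.mk := by
  rw [FlagOfForms.pIsom, h.isom_eq]

end Frames

end PartialFlagGeometry

namespace PartialFlagGeometry

/-! ### Reflections -/

section Reflection

variable {ι α : Type*} [Fintype ι] [DecidableEq ι] [LinearOrder α]

/-- The reflection in a vector on which the form of level `i` does not vanish. -/
lemma exists_reflection {l : ι → α} {w u : ι → ℝ} {i : α} (hu : ∀ j, l j < i → u j = 0)
    (hq : ∑ j with l j = i, w j * u j ^ 2 ≠ 0) :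
    ∃ r ∈ diagIsom l w, r⁻¹ = r ∧ r.1 = 1 - (2 / ∑ j with l j = i, w j * u j ^ 2) •
      Matrix.vecMulVec u (fun j => if l j = i then w j * u j else 0) := by
  set q := ∑ j with l j = i, w j * u j ^ 2 with hqdef
  -- `φ` is the pairing with `u` under the level-`i` form. It is supported on level `i`, and `u` has
  -- no coordinate below level `i`, so the rank-one term is filtered even when `u` has coordinates
  -- of higher levels.
  set φ : ι → ℝ := fun j => if l j = i then w j * u j else 0 with hφ
  have hφu : φ ⬝ᵥ u = q := by
    rw [hqdef, Finset.sum_filter]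
    exact Finset.sum_congr rfl fun j _ => by simp only [φ]; split_ifs <;> ring
  set R : Matrix ι ι ℝ := 1 - (2 / q) • Matrix.vecMulVec u φ with hR
  have hRR : R * R = 1 := by
    have h1 : Matrix.vecMulVec u φ * Matrix.vecMulVec u φ = q • Matrix.vecMulVec u φ := by
      rw [Matrix.vecMulVec_mul_vecMulVec, hφu]
      ext i j
      simp only [Matrix.smul_apply, Matrix.vecMulVec_apply, Pi.smul_apply, smul_eq_mul]
      ring
    rw [hR, sub_mul, one_mul, mul_sub, mul_one, smul_mul_smul_comm, h1, smul_smul]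
    have : 2 / q * (2 / q) * q = 2 / q + 2 / q := by field_simp; norm_num
    rw [this, add_smul]
    abel
  have hfil : IsFiltered l R := by
    intro a b hab
    have hne : a ≠ b := fun e => hab.ne (e ▸ rfl)
    rw [hR, Matrix.sub_apply, Matrix.one_apply_ne hne, Matrix.smul_apply, Matrix.vecMulVec_apply]
    by_cases hb : l b = i
    · rw [hu a (hb ▸ hab), zero_mul, smul_zero, sub_zero]
    · simp [φ, hb]
  refine ⟨⟨R, R, hRR, hRR⟩, ⟨hfil, hfil, fun a b hab => ?_⟩, rfl, rfl⟩
  change w a * R a b = w b * R b a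
  by_cases e : a = b
  · subst e; rfl
  · simp only [R, φ, Matrix.sub_apply, Matrix.smul_apply, Matrix.vecMulVec_apply, hab,
      Matrix.one_apply_ne e, Matrix.one_apply_ne (Ne.symm e), smul_eq_mul]
    split_ifs <;> ring

end Reflection

/-! ### The domain: invariance, transitivity, openness and connectedness -/

section Domain

variable {n k : ℕ} {F : PartialFlag n k} {β : FlagOfForms F} {A : GL (Fin n) ℝ}
  {l : Fin n → Fin (k + 1)} {w : Fin n → ℝ}

/-- The diagonal form of the top level. -/
noncomputable def topForm (l : Fin n → Fin (k + 1)) (w x : Fin n → ℝ) : ℝ :=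
  ∑ j with l j = 0, w j * x j ^ 2

lemma topForm_smul (c : ℝ) (x : Fin n → ℝ) : topForm l w (c • x) = c ^ 2 * topForm l w x := by
  rw [topForm, topForm, Finset.mul_sum]
  exact Finset.sum_congr rfl fun j _ => by rw [Pi.smul_apply, smul_eq_mul]; ring

/-- The bilinear form of `topForm`. -/
noncomputable def topBilin (l : Fin n → Fin (k + 1)) (w x y : Fin n → ℝ) : ℝ :=
  ∑ j with l j = 0, w j * (x j * y j)

lemma topForm_add_smul (c : ℝ) (x y : Fin n → ℝ) :
    topForm l w (x + c • y) =
      topForm l w x + 2 * c * topBilin l w x y + c ^ 2 * topForm l w y := by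
  simp only [topForm, topBilin, Finset.mul_sum, ← Finset.sum_add_distrib]
  exact Finset.sum_congr rfl fun j _ => by rw [Pi.add_apply, Pi.smul_apply, smul_eq_mul]; ring

lemma topForm_single {a : Fin n} (ha : l a = 0) (c : ℝ) :
    topForm l w (Pi.single a c) = w a * c ^ 2 := by
  rw [topForm, Finset.sum_eq_single a (fun c _ hc => by simp [hc]) (fun h => by simp [ha] at h)]
  simp

lemma topForm_zero : topForm l w 0 = 0 := by simp [topForm]

lemma continuous_topForm : Continuous (topForm l w) := by
  unfold topForm; fun_prop

lemma mulVec_ne_zero (A : GL (Fin n) ℝ) {x : Fin n → ℝ} (hx : x ≠ 0) : A.1 *ᵥ x ≠ 0 := by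
  intro h
  apply hx
  rw [← inv_mulVec_mulVec A x, h, Matrix.mulVec_zero]

lemma IsFrame.mk_mem_domain (h : IsFrame β A l w) {v : Fin n → ℝ} (hv : v ≠ 0) :
    Projectivization.mk ℝ v hv ∈ β.domain ↔ topForm l w (A⁻¹.1 *ᵥ v) < 0 := by
  have key : ∀ x : F.V (0 : Fin (k + 1)).castSucc,
      β.pullback 0 x = topForm l w (A⁻¹.1 *ᵥ (x : Fin n → ℝ)) := by
    intro x
    have hx : A.1 *ᵥ (A⁻¹.1 *ᵥ (x : Fin n → ℝ)) ∈ F.V (0 : Fin (k + 1)).castSucc := by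
      rw [mulVec_inv_mulVec]; exact x.2
    have := h.pullback 0 _ hx
    simp only [mulVec_inv_mulVec] at this
    exact this
  constructor
  · rintro ⟨x, hx, hmk, hneg⟩
    obtain ⟨c, hc⟩ := (Projectivization.mk_eq_mk_iff' ℝ _ _ hv hx).1 hmk
    rw [key] at hneg
    have hc0 : c ≠ 0 := by
      rintro rfl
      exact hv (by rw [← hc, zero_smul])
    rw [← hc, Matrix.mulVec_smul, topForm_smul]
    exact mul_neg_of_pos_of_neg (by positivity) hneg
  · intro hneg
    have hmem : v ∈ F.V (0 : Fin (k + 1)).castSucc := by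
      have : F.V (0 : Fin (k + 1)).castSucc = ⊤ := F.zero_eq
      rw [this]; trivial
    exact ⟨⟨v, hmem⟩, hv, rfl, by rw [key]; exact hneg⟩

lemma IsFrame.mk_mulVec_mem_domain (h : IsFrame β A l w) {x : Fin n → ℝ} (hx : x ≠ 0) :
    Projectivization.mk ℝ (A.1 *ᵥ x) (mulVec_ne_zero A hx) ∈ β.domain ↔ topForm l w x < 0 := by
  rw [h.mk_mem_domain, inv_mulVec_mulVec]

lemma exists_mk_mulVec (A : GL (Fin n) ℝ) (z : ℙ ℝ (Fin n → ℝ)) :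
    ∃ (x : Fin n → ℝ) (hx : x ≠ 0),
      z = Projectivization.mk ℝ (A.1 *ᵥ x) (mulVec_ne_zero A hx) := by
  induction z using Projectivization.ind with
  | _ v hv =>
    refine ⟨A⁻¹.1 *ᵥ v, mulVec_ne_zero A⁻¹ hv, ?_⟩
    simp only [mulVec_inv_mulVec]

lemma mk_smul_mk_mulVec (A g : GL (Fin n) ℝ) {x : Fin n → ℝ} (hx : x ≠ 0) :
    (Matrix.ProjGenLinGroup.mk (A * g * A⁻¹) : PGL(n, ℝ)) •
      Projectivization.mk ℝ (A.1 *ᵥ x) (mulVec_ne_zero A hx) =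
    Projectivization.mk ℝ (A.1 *ᵥ (g.1 *ᵥ x)) (mulVec_ne_zero A (mulVec_ne_zero g hx)) := by
  rw [Projectivization.PGL.mk_smul_mk]
  congr 1
  change (A * g * A⁻¹).1 *ᵥ (A.1 *ᵥ x) = _
  rw [Matrix.mulVec_mulVec, Matrix.mulVec_mulVec, ← Units.val_mul, ← Units.val_mul]
  simp [mul_assoc]

lemma topForm_mulVec {g : GL (Fin n) ℝ} (hg : g ∈ diagIsom l w) (x : Fin n → ℝ) :
    topForm l w (g.1 *ᵥ x) = topForm l w x :=
  IsAdjointPair.sum_mulVec_sq hg fun _ hj => absurd hj (Fin.not_lt_zero _)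

/-- The group acts transitively on the vectors of a given negative value. -/
lemma exists_mem_diagIsom_mulVec_eq {x y : Fin n → ℝ} (hx : topForm l w x < 0)
    (hxy : topForm l w x = topForm l w y) :
    ∃ g ∈ diagIsom l w, g.1 *ᵥ x = y := by
  have refl : ∀ u : Fin n → ℝ, topForm l w u ≠ 0 → ∃ r ∈ diagIsom l w, ∀ v : Fin n → ℝ,
      r.1 *ᵥ v = v - (2 * topBilin l w u v / topForm l w u) • u := by
    intro u hu
    obtain ⟨r, hr, -, hrv⟩ := exists_reflection (l := l) (w := w) (i := 0) (u := u)
      (fun j hj => absurd hj (Fin.not_lt_zero _)) hu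
    refine ⟨r, hr, fun v => ?_⟩
    have hφ : (fun j => if l j = 0 then w j * u j else 0) ⬝ᵥ v = topBilin l w u v := by
      rw [topBilin, Finset.sum_filter]
      exact Finset.sum_congr rfl fun j _ => by dsimp only; split_ifs <;> ring
    rw [hrv, Matrix.sub_mulVec, Matrix.one_mulVec, Matrix.smul_mulVec, Matrix.vecMulVec_mulVec, hφ]
    congr 1
    ext j
    simp only [Pi.smul_apply, smul_eq_mul, MulOpposite.smul_eq_mul_unop, MulOpposite.unop_op,
      topForm]
    ring
  have hpm : ∀ c : ℝ, topForm l w (x + c • y) =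
      topForm l w x + 2 * c * topBilin l w x y + c ^ 2 * topForm l w x := by
    intro c; rw [topForm_add_smul, ← hxy]
  have hb : ∀ c : ℝ, topBilin l w (x + c • y) x = topForm l w x + c * topBilin l w x y := by
    intro c
    simp only [topForm, topBilin, Finset.mul_sum, ← Finset.sum_add_distrib]
    exact Finset.sum_congr rfl fun j _ => by rw [Pi.add_apply, Pi.smul_apply, smul_eq_mul]; ring
  -- As `x` and `y` have the same value, the reflection in `x ± y` takes `x` to `∓y`, including all
  -- the coordinates of higher levels.
  have hr : ∀ c : ℝ, c ^ 2 = 1 → topForm l w (x + c • y) ≠ 0 →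
      ∃ r ∈ diagIsom l w, r.1 *ᵥ x = -c • y := by
    intro c hc h0
    obtain ⟨r, hr, hrv⟩ := refl _ h0
    refine ⟨r, hr, ?_⟩
    have : 2 * topBilin l w (x + c • y) x / topForm l w (x + c • y) = 1 := by
      rw [div_eq_one_iff_eq h0, hb, hpm, hc]; ring
    rw [hrv, this, one_smul, neg_smul]
    abel
  -- The values at `x + y` and `x - y` add up to four times the nonzero value at `x`, so one of the
  -- two reflections exists.
  by_cases h : topForm l w (x + (-1 : ℝ) • y) = 0
  · have h' : topForm l w (x + (1 : ℝ) • y) ≠ 0 := by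
      rw [hpm] at h ⊢
      intro h'
      linarith
    obtain ⟨r, hr, hrx⟩ := hr 1 (by norm_num) h'
    refine ⟨-r, neg_mem_diagIsom hr, ?_⟩
    rw [Units.val_neg, Matrix.neg_mulVec, hrx]
    simp
  · obtain ⟨r, hr, hrx⟩ := hr (-1) (by norm_num) h
    exact ⟨r, hr, by rw [hrx]; simp⟩

lemma smul_mem_domain (h : IsFrame β A l w) {g : PGL(n, ℝ)} (hg : g ∈ β.pIsom)
    {z : ℙ ℝ (Fin n → ℝ)} (hz : z ∈ β.domain) : g • z ∈ β.domain := by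
  rw [h.pIsom_eq] at hg
  obtain ⟨_, ⟨r, hr, rfl⟩, rfl⟩ := hg
  obtain ⟨x, hx, rfl⟩ := exists_mk_mulVec A z
  change (Matrix.ProjGenLinGroup.mk (A * r * A⁻¹) : PGL(n, ℝ)) • _ ∈ _
  rw [mk_smul_mk_mulVec _ _ hx, h.mk_mulVec_mem_domain (mulVec_ne_zero r hx), topForm_mulVec hr]
  exact (h.mk_mulVec_mem_domain hx).1 hz

lemma exists_smul_eq (h : IsFrame β A l w) {y z : ℙ ℝ (Fin n → ℝ)} (hy : y ∈ β.domain)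
    (hz : z ∈ β.domain) : ∃ g ∈ β.pIsom, g • y = z := by
  obtain ⟨x, hx, rfl⟩ := exists_mk_mulVec A y
  obtain ⟨x', hx', rfl⟩ := exists_mk_mulVec A z
  rw [h.mk_mulVec_mem_domain hx] at hy
  rw [h.mk_mulVec_mem_domain hx'] at hz
  have hpos : 0 < topForm l w x / topForm l w x' := div_pos_of_neg_of_neg hy hz
  set c := Real.sqrt (topForm l w x / topForm l w x') with hc
  have hc2 : c ^ 2 = topForm l w x / topForm l w x' := Real.sq_sqrt hpos.le
  have hc0 : c ≠ 0 := (Real.sqrt_pos.2 hpos).ne'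
  obtain ⟨g, hg, hgx⟩ := exists_mem_diagIsom_mulVec_eq (y := c • x') hy (by
    rw [topForm_smul, hc2, div_mul_cancel₀ _ hz.ne])
  refine ⟨Matrix.ProjGenLinGroup.mk (A * g * A⁻¹), ?_, ?_⟩
  · rw [h.pIsom_eq]
    exact ⟨_, ⟨g, hg, rfl⟩, rfl⟩
  · rw [mk_smul_mk_mulVec _ _ hx, Projectivization.mk_eq_mk_iff']
    exact ⟨c, by rw [hgx, Matrix.mulVec_smul]⟩

lemma continuous_projMk :
    Continuous (fun v : {v : Fin n → ℝ // v ≠ 0} => Projectivization.mk ℝ v.1 v.2) :=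
  continuous_coinduced_rng

lemma IsFrame.isOpen_domain (h : IsFrame β A l w) : IsOpen β.domain := by
  refine isOpen_coinduced.2 ?_
  have : (fun v : {v : Fin n → ℝ // v ≠ 0} => Projectivization.mk ℝ v.1 v.2) ⁻¹' β.domain =
      {v | topForm l w (A⁻¹.1 *ᵥ v.1) < 0} := by
    ext v
    exact h.mk_mem_domain v.2
  rw [this]
  exact isOpen_lt (continuous_topForm.comp
    (Continuous.matrix_mulVec continuous_const continuous_subtype_val)) continuous_const

/-- Changing the sign of a representative makes the pairing of two negative vectors nonpositive;
then the form is negative along the whole segment between them. -/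
lemma IsFrame.isConnected_domain (h : IsFrame β A l w) {y : ℙ ℝ (Fin n → ℝ)}
    (hy : y ∈ β.domain) : IsConnected β.domain := by
  refine IsPathConnected.isConnected ⟨y, hy, fun {z} hz => ?_⟩
  obtain ⟨e, he, rfl⟩ := exists_mk_mulVec A y
  obtain ⟨x, hx, rfl⟩ := exists_mk_mulVec A z
  rw [h.mk_mulVec_mem_domain he] at hy
  rw [h.mk_mulVec_mem_domain hx] at hz
  obtain ⟨s, hs, hsb⟩ : ∃ s : ℝ, s ^ 2 = 1 ∧ topBilin l w e (s • x) ≤ 0 := by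
    have : ∀ s : ℝ, topBilin l w e (s • x) = s * topBilin l w e x := by
      intro s
      rw [topBilin, topBilin, Finset.mul_sum]
      exact Finset.sum_congr rfl fun j _ => by rw [Pi.smul_apply, smul_eq_mul]; ring
    rcases le_total (topBilin l w e x) 0 with h0 | h0
    · exact ⟨1, by norm_num, by rw [this]; linarith⟩
    · exact ⟨-1, by norm_num, by rw [this]; linarith⟩
  have hz' : topForm l w (s • x) < 0 := by rw [topForm_smul, hs, one_mul]; exact hz
  let f : ℝ → Fin n → ℝ := fun t => (1 - t) • e + t • (s • x)
  have hf : ∀ t ∈ Set.Icc (0 : ℝ) 1, topForm l w (f t) < 0 := by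
    intro t ht
    have e1 : topForm l w (f t) = (1 - t) ^ 2 * topForm l w e +
        2 * t * (1 - t) * topBilin l w e (s • x) + t ^ 2 * topForm l w (s • x) := by
      simp only [f]
      rw [topForm_add_smul, topForm_smul]
      have : topBilin l w ((1 - t) • e) (s • x) = (1 - t) * topBilin l w e (s • x) := by
        rw [topBilin, topBilin, Finset.mul_sum]
        exact Finset.sum_congr rfl fun j _ => by rw [Pi.smul_apply, smul_eq_mul]; ring
      rw [this]; ring
    rw [e1]
    have h1 : 2 * t * (1 - t) * topBilin l w e (s • x) ≤ 0 :=
      mul_nonpos_of_nonneg_of_nonpos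
        (mul_nonneg (mul_nonneg two_pos.le ht.1) (sub_nonneg.2 ht.2)) hsb
    rcases ht.1.eq_or_lt with h0 | h0
    · rw [← h0]; simpa using hy
    · have h2 : t ^ 2 * topForm l w (s • x) < 0 := mul_neg_of_pos_of_neg (by positivity) hz'
      have h3 : (1 - t) ^ 2 * topForm l w e ≤ 0 :=
        mul_nonpos_of_nonneg_of_nonpos (sq_nonneg _) hy.le
      linarith
  have hf0 : ∀ t ∈ Set.Icc (0 : ℝ) 1, f t ≠ 0 := by
    intro t ht h0
    have := hf t ht
    rw [h0, topForm_zero] at this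
    exact lt_irrefl _ this
  let γ : unitInterval → ℙ ℝ (Fin n → ℝ) := fun t =>
    Projectivization.mk ℝ (A.1 *ᵥ f t) (mulVec_ne_zero A (hf0 t t.2))
  have hγ : Continuous γ := by
    refine continuous_projMk.comp (f := fun t : unitInterval =>
      (⟨A.1 *ᵥ f t, mulVec_ne_zero A (hf0 t t.2)⟩ : {v : Fin n → ℝ // v ≠ 0})) ?_
    refine Continuous.subtype_mk (Continuous.matrix_mulVec continuous_const ?_) _
    fun_prop
  refine ⟨⟨⟨γ, hγ⟩, ?_, ?_⟩, fun t => (h.mk_mulVec_mem_domain (hf0 t t.2)).2 (hf t t.2)⟩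
  · change Projectivization.mk ℝ _ _ = _
    congr 1
    simp [f]
  · change Projectivization.mk ℝ _ _ = _
    rw [Projectivization.mk_eq_mk_iff']
    refine ⟨s, ?_⟩
    simp [f, Matrix.mulVec_smul]

lemma PartialFlag.ne_zero (F : PartialFlag n k) : n ≠ 0 := by
  rintro rfl
  have := F.strictAnti (Fin.last_pos (n := k))
  rw [F.zero_eq, F.last_eq] at this
  exact this.ne (Subsingleton.elim _ _)

lemma IsFrame.isSubgeometry (h : IsFrame β A l w) (hne : β.domain.Nonempty) :
    IsSubgeometry β.domain β.pIsom where
  isClosed := by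
    rw [h.pIsom_eq]
    exact isClosed_map_frameIsom F.ne_zero h.ne_zero
  isOpen := h.isOpen_domain
  isConnected := h.isConnected_domain hne.some_mem
  smul_mem := fun _ hg _ hz => smul_mem_domain h hg hz
  transitive := fun _ hy _ hz => exists_smul_eq h hy hz

end Domain

end PartialFlagGeometry

namespace PartialFlagGeometry

/-! ### Construction of frames and of flags of forms -/

section Existence

variable {n k : ℕ} {F : PartialFlag n k} {β : FlagOfForms F} {A : GL (Fin n) ℝ}
  {l : Fin n → Fin (k + 1)} {w : Fin n → ℝ}

lemma exists_isFlagFrame (A : GL (Fin n) ℝ) (hl : Function.Surjective l) :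
    ∃ F : PartialFlag n k, IsFlagFrame F A l := by
  let V : Fin (k + 2) → Submodule ℝ (Fin n → ℝ) := fun i =>
    { carrier := {v | ∀ j, (l j).castSucc < i → (A⁻¹.1 *ᵥ v) j = 0}
      zero_mem' := by intro j _; rw [Matrix.mulVec_zero]; rfl
      add_mem' := by
        intro u v hu hv j hj
        rw [Matrix.mulVec_add, Pi.add_apply, hu j hj, hv j hj, add_zero]
      smul_mem' := by
        intro c v hv j hj
        rw [Matrix.mulVec_smul, Pi.smul_apply, hv j hj, smul_zero] }
  have hV : ∀ i v, v ∈ V i ↔ ∀ j, (l j).castSucc < i → (A⁻¹.1 *ᵥ v) j = 0 := fun _ _ => Iff.rfl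
  refine ⟨⟨V, ?_, ?_, ?_⟩, fun i x => ?_⟩
  · rw [Fin.strictAnti_iff_succ_lt]
    intro i
    refine SetLike.lt_iff_le_and_exists.2 ⟨fun v hv j hj => hv j (hj.trans Fin.castSucc_lt_succ), ?_⟩
    obtain ⟨j, hj⟩ := hl i
    refine ⟨A.1 *ᵥ Pi.single j 1, ?_, fun h => ?_⟩
    · rw [hV, inv_mulVec_mulVec]
      intro a ha
      refine Pi.single_eq_of_ne ?_ _
      rintro rfl
      exact (Fin.castSucc_lt_castSucc_iff.1 ha).ne hj
    · have := h j (by rw [hj]; exact Fin.castSucc_lt_succ)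
      rw [inv_mulVec_mulVec, Pi.single_eq_same] at this
      exact one_ne_zero this
  · exact eq_top_iff.2 fun v _ j hj => absurd hj (Fin.not_lt_zero _)
  · refine eq_bot_iff.2 fun v hv => ?_
    have : A⁻¹.1 *ᵥ v = 0 := funext fun j => hv j (Fin.castSucc_lt_last _)
    rw [Submodule.mem_bot, ← mulVec_inv_mulVec A v, this, Matrix.mulVec_zero]
  · rw [hV, inv_mulVec_mulVec]

/-- Diagonal forms in a frame define a flag of forms. -/
lemma exists_isFrame (A : GL (Fin n) ℝ) (hl : Function.Surjective l) (hw : ∀ j, w j ≠ 0) :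
    ∃ (F : PartialFlag n k) (β : FlagOfForms F), IsFrame β A l w := by
  obtain ⟨F, hF⟩ := exists_isFlagFrame A hl
  choose e he using fun i => hF.exists_quotEquiv i
  let Q : ∀ i, QuadraticForm ℝ (F.Quot i) := fun i =>
    (QuadraticMap.weightedSumSquares ℝ fun j : {j // l j = i} => w j).comp (e i).toLinearMap
  have hQ : ∀ i, (Q i).Equivalent
      (QuadraticMap.weightedSumSquares ℝ fun j : {j // l j = i} => w j) :=
    fun i => ⟨⟨e i, fun _ => rfl⟩⟩
  refine ⟨F, ⟨Q, fun i => ?_⟩, hF, fun i x hx => ?_⟩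
  · rw [QuadraticMap.nondegenerate_iff_radical_eq_bot, ← Submodule.finrank_eq_zero (R := ℝ),
      QuadraticForm.finrank_radical_of_equiv_weightedSumSquares (hQ i), Set.ncard_eq_zero
      (Set.toFinite _)]
    exact Set.eq_empty_of_forall_notMem fun j hj => hw j hj
  · change QuadraticMap.weightedSumSquares ℝ (fun j : {j // l j = i} => w j)
      (e i (Submodule.Quotient.mk ⟨A.1 *ᵥ x, hx⟩)) = _
    rw [QuadraticMap.weightedSumSquares_apply,
      Finset.sum_subtype (p := fun j => l j = i) _ (by simp)]
    refine Finset.sum_congr rfl fun j _ => ?_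
    rw [he, inv_mulVec_mulVec, smul_eq_mul, sq]

lemma IsFlagFrame.single_mem (h : IsFlagFrame F A l) (a : Fin n) :
    A.1 *ᵥ Pi.single a 1 ∈ F.V (l a).castSucc := by
  rw [h]
  intro j hj
  refine Pi.single_eq_of_ne ?_ _
  rintro rfl
  exact lt_irrefl _ hj

/-- A frame of the flag is a frame of the forms as soon as it is orthogonal for every form. -/
lemma IsFlagFrame.exists_isFrame (h : IsFlagFrame F A l)
    (hβ : ∀ a b, a ≠ b → ∀ (hab : l b = l a),
      QuadraticMap.polar (β.pullback (l a)) ⟨_, h.single_mem a⟩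
        ⟨A.1 *ᵥ Pi.single b 1, hab ▸ h.single_mem b⟩ = 0) :
    ∃ w, IsFrame β A l w := by
  classical
  refine ⟨fun j => β.pullback (l j) ⟨_, h.single_mem j⟩, h, fun i x hx => ?_⟩
  obtain ⟨e, he⟩ := h.exists_quotEquiv i
  let Q : QuadraticForm ℝ ({j // l j = i} → ℝ) := (β.form i).comp e.symm.toLinearMap
  let B := Pi.basisFun ℝ {j // l j = i}
  have hmem : ∀ j : {j // l j = i}, A.1 *ᵥ Pi.single j.1 1 ∈ F.V i.castSucc := by
    rintro ⟨j, rfl⟩; exact h.single_mem j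
  have hB : ∀ j : {j // l j = i}, e.symm (B j) = Submodule.Quotient.mk ⟨_, hmem j⟩ := by
    intro j
    rw [LinearEquiv.symm_apply_eq]
    funext a
    rw [he, inv_mulVec_mulVec, Pi.basisFun_apply]
    by_cases haj : a = j
    · subst haj; simp
    · rw [Pi.single_eq_of_ne haj, Pi.single_eq_of_ne fun h => haj (Subtype.ext h)]
  have hQB : ∀ j : {j // l j = i}, Q (B j) = β.pullback i ⟨_, hmem j⟩ := by
    intro j
    change β.form i (e.symm (B j)) = _
    rw [hB]; rfl
  have hortho : (QuadraticMap.associated Q).IsOrthoᵢ B := by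
    rintro ⟨a, ha⟩ ⟨b, hb⟩ hab
    subst ha
    have hpol : QuadraticMap.polar Q (B ⟨a, rfl⟩) (B ⟨b, hb⟩) = 0 := by
      rw [← hβ a b (fun e => hab (Subtype.ext e)) hb]
      simp only [QuadraticMap.polar, hQB]
      congr 2
      change β.form _ (e.symm _) = _
      rw [map_add, hB, hB]
      rfl
    change QuadraticMap.associated Q (B _) (B _) = 0
    rw [QuadraticMap.associated_apply]
    simp only [QuadraticMap.polar] at hpol
    simp [hpol]
  have key := congrArg (fun q => q fun j : {j // l j = i} => x j)
    (QuadraticMap.basisRepr_eq_of_iIsOrtho Q B hortho)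
  simp only [QuadraticMap.basisRepr_apply, QuadraticMap.weightedSumSquares_apply] at key
  have hx' : ∑ j : {j // l j = i}, x j • B j = e (Submodule.Quotient.mk ⟨_, hx⟩) := by
    funext a
    rw [he, inv_mulVec_mulVec]
    simp [B, Finset.sum_apply, Pi.single_apply]
  have hl : Q (∑ j : {j // l j = i}, x j • B j) = β.pullback i ⟨_, hx⟩ := by
    rw [hx']
    change β.form i (e.symm _) = _
    rw [LinearEquiv.symm_apply_apply]
    rfl
  rw [← hl, key, Finset.sum_subtype (p := fun j => l j = i) _ (by simp)]
  refine Finset.sum_congr rfl ?_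
  rintro ⟨j, rfl⟩ -
  rw [hQB, smul_eq_mul, sq]

/-- A frame whose coordinate reflections are isometries diagonalizes the forms. -/
lemma exists_isFrame_of_signMatrix_mem
    (h : ∀ s, A * signMatrix s * A⁻¹ ∈ β.isom) : ∃ l w, IsFrame β A l w := by
  classical
  have hs : ∀ (s : Fin n → ℤˣ) x, (A * signMatrix s * A⁻¹).1 *ᵥ (A.1 *ᵥ x) =
      A.1 *ᵥ ((signMatrix s).1 *ᵥ x) := by
    intro s x
    rw [Matrix.mulVec_mulVec, Matrix.mulVec_mulVec, ← Units.val_mul, ← Units.val_mul]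
    simp [mul_assoc]
  have hmem : ∀ (s : Fin n → ℤˣ) i x, A.1 *ᵥ x ∈ F.V i →
      A.1 *ᵥ ((signMatrix s).1 *ᵥ x) ∈ F.V i := by
    intro s i x hx
    rw [← hs, ← (h s).1 i]
    exact ⟨_, hx, rfl⟩
  let s : Fin n → Fin n → ℤˣ := fun j => Function.update 1 j (-1)
  have hsx : ∀ j x, (signMatrix (s j)).1 *ᵥ x = x - (2 * x j) • Pi.single j 1 := by
    intro j x
    funext a
    rw [val_signMatrix, Matrix.mulVec_diagonal]
    by_cases haj : a = j
    · subst haj; simp [s]; ring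
    · simp [s, haj]
  -- Subtracting from `x` its image under the sign change `s j` leaves `2 * x j` times the `j`-th
  -- basis vector, so every flag subspace is spanned by frame vectors.
  have hcoord : ∀ i x, A.1 *ᵥ x ∈ F.V i → ∀ j, x j ≠ 0 → A.1 *ᵥ Pi.single j 1 ∈ F.V i := by
    intro i x hx j hj
    have h1 := sub_mem hx (hmem (s j) i x hx)
    rw [hsx, ← Matrix.mulVec_sub, sub_sub_cancel, Matrix.mulVec_smul] at h1
    exact (Submodule.smul_mem_iff _ (by simpa using hj)).1 h1
  have hlev : ∀ j, ∃ i : Fin (k + 1), A.1 *ᵥ Pi.single j 1 ∈ F.V i.castSucc ∧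
      A.1 *ᵥ Pi.single j 1 ∉ F.V i.succ := by
    intro j
    by_contra hcon
    push Not at hcon
    have hall : ∀ i, A.1 *ᵥ Pi.single j 1 ∈ F.V i := by
      intro i
      induction i using Fin.induction with
      | zero => rw [F.zero_eq]; trivial
      | succ i ih => exact hcon i ih
    have := hall (Fin.last (k + 1))
    rw [F.last_eq, Submodule.mem_bot] at this
    exact mulVec_ne_zero A (by simp) this
  choose l hl hl' using hlev
  have hflag : IsFlagFrame F A l := by
    intro i x
    constructor
    · intro hx j hj
      by_contra hxj
      exact hl' j (F.strictAnti.antitone (Fin.castSucc_lt_iff_succ_le.1 hj) (hcoord i x hx j hxj))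
    · intro hx
      have : x = ∑ j, x j • (Pi.single j 1 : Fin n → ℝ) := by
        funext a; simp [Finset.sum_apply, Pi.single_apply]
      rw [this, Matrix.mulVec_sum]
      refine Submodule.sum_mem _ fun j _ => ?_
      rw [Matrix.mulVec_smul]
      by_cases hj : (l j).castSucc < i
      · rw [hx j hj, zero_smul]; exact zero_mem _
      · exact Submodule.smul_mem _ _ (F.strictAnti.antitone (not_lt.1 hj) (hl j))
  obtain ⟨w, hw⟩ := hflag.exists_isFrame (β := β) fun a b hab hlab => by
    have hb : A.1 *ᵥ Pi.single b 1 ∈ F.V (l a).castSucc := hlab ▸ hflag.single_mem b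
    set u : F.V (l a).castSucc := ⟨_, hflag.single_mem a⟩
    set v : F.V (l a).castSucc := ⟨_, hb⟩
    -- The sign change of coordinate `b` takes `u + v` to `u - v`, so the polar form at `(u, v)`
    -- equals its own negative.
    have h1 : β.pullback (l a) (u + -v) = β.pullback (l a) (u + v) := by
      refine (h (s b)).2 (l a) (u + v) (u + -v) ?_
      have e1 : ((u + v : F.V (l a).castSucc) : Fin n → ℝ) =
          A.1 *ᵥ (Pi.single a 1 + Pi.single b 1) := by rw [Matrix.mulVec_add]; rfl
      have e2 : ((u + -v : F.V (l a).castSucc) : Fin n → ℝ) =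
          A.1 *ᵥ (Pi.single a 1 + -Pi.single b 1) := by
        rw [Matrix.mulVec_add, Matrix.mulVec_neg]; rfl
      rw [e1, e2, hs, hsx]
      congr 1
      funext c
      simp [Pi.single_eq_of_ne (Ne.symm hab)]
      ring
    have h2 : QuadraticMap.polar (β.pullback (l a)) u (-v) =
        QuadraticMap.polar (β.pullback (l a)) u v := by
      rw [QuadraticMap.polar, QuadraticMap.polar, h1, QuadraticMap.map_neg]
    rw [QuadraticMap.polar_neg_right] at h2
    linarith
  exact ⟨l, w, hw⟩

end Existence

end PartialFlagGeometry

namespace PartialFlagGeometry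

/-! ### Orthonormal frames adapted to a flag of forms -/

section OrthonormalFrames

/-- A quadratic form on a Euclidean space is diagonal in some orthonormal basis. -/
lemma exists_orthonormalBasis_polar_eq_zero {W : Type*} [NormedAddCommGroup W]
    [InnerProductSpace ℝ W] [FiniteDimensional ℝ W] (q : QuadraticForm ℝ W) :
    ∃ b : OrthonormalBasis (Fin (Module.finrank ℝ W)) ℝ W,
      ∀ i j, i ≠ j → QuadraticMap.polar q (b i) (b j) = 0 := by
  -- The self-adjoint operator representing the polar form of `q`; an orthonormal eigenbasis of it
  -- is orthogonal for `q`.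
  let T : W →ₗ[ℝ] W :=
    { toFun := fun x => (InnerProductSpace.toDual ℝ W).symm
        (LinearMap.toContinuousLinearMap (q.polarBilin x))
      map_add' := fun x y => by rw [map_add, map_add, map_add]
      map_smul' := fun c x => by rw [map_smul, map_smul, map_smulₛₗ]; rfl }
  have hT : ∀ x y, inner ℝ (T x) y = QuadraticMap.polar q x y := fun x y => by
    change inner ℝ ((InnerProductSpace.toDual ℝ W).symm _) y = _
    rw [InnerProductSpace.toDual_symm_apply]
    rfl
  have hsymm : T.IsSymmetric := fun x y => by
    rw [real_inner_comm (T y) x, hT, hT, QuadraticMap.polar_comm]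
  refine ⟨hsymm.eigenvectorBasis rfl, fun i j hij => ?_⟩
  rw [← hT, hsymm.apply_eigenvectorBasis, inner_smul_left,
    (hsymm.eigenvectorBasis rfl).orthonormal.2 hij, mul_zero]

lemma polar_comp_linearMap {M N : Type*} [AddCommGroup M] [Module ℝ M] [AddCommGroup N]
    [Module ℝ N] (q : QuadraticForm ℝ N) (f : M →ₗ[ℝ] N) (x y : M) :
    QuadraticMap.polar (q.comp f) x y = QuadraticMap.polar q (f x) (f y) := by
  simp [QuadraticMap.polar]

/-- A flag of subspaces with a quadratic form on each of them has an adapted orthonormal basis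
that is orthogonal for the forms. -/
lemma exists_orthonormalBasis_adapted {E : Type*} [NormedAddCommGroup E] [InnerProductSpace ℝ E]
    [FiniteDimensional ℝ E] {n k : ℕ} (hn : Module.finrank ℝ E = n)
    (V : Fin (k + 2) → Submodule ℝ E) (hV : Antitone V) (h0 : V 0 = ⊤)
    (hlast : V (Fin.last (k + 1)) = ⊥)
    (q : ∀ i : Fin (k + 1), QuadraticForm ℝ (V i.castSucc)) :
    ∃ (B : OrthonormalBasis (Fin n) ℝ E) (l : Fin n → Fin (k + 1)),
      (∀ i v, v ∈ V i ↔ ∀ j, (l j).castSucc < i → inner ℝ (B j) v = 0) ∧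
      ∀ a c, a ≠ c → ∀ i, l a = i → l c = i → ∀ u v : V i.castSucc,
        (u : E) = B a → (v : E) = B c → QuadraticMap.polar (q i) u v = 0 := by
  classical
  -- The orthogonal complement of `V (i + 1)` in `V i`. These pieces are mutually orthogonal and
  -- span `E`, so orthonormal bases diagonalizing `q i` on each of them combine into one basis.
  let W : Fin (k + 1) → Submodule ℝ E := fun i => (V i.succ)ᗮ ⊓ V i.castSucc
  have hW : ∀ i j, i < j → ∀ u ∈ W i, ∀ v ∈ W j, inner ℝ v u = 0 := by
    intro i j hij u hu v hv
    exact hu.1 v (hV (Fin.succ_le_castSucc_iff.2 hij) hv.2)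
  have hortho : OrthogonalFamily ℝ (fun i => W i) fun i => (W i).subtypeₗᵢ := by
    intro i j hij u v
    rcases lt_or_gt_of_ne hij with h | h
    · rw [real_inner_comm]
      exact hW i j h u u.2 v v.2
    · exact hW j i h v v.2 u u.2
  have hsup : ∀ i, V i ≤ iSup W := by
    intro i
    induction i using Fin.reverseInduction with
    | last => rw [hlast]; exact bot_le
    | cast i ih =>
      rw [← Submodule.sup_orthogonal_inf_of_hasOrthogonalProjection
        (hV (Fin.castSucc_le_succ i))]
      exact sup_le ih (le_iSup W i)
  have hint : DirectSum.IsInternal W := by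
    have htop : iSup W = ⊤ := by rw [eq_top_iff, ← h0]; exact hsup 0
    rw [hortho.isInternal_iff, htop, Submodule.top_orthogonal_eq_bot]
  choose b hb using fun i => exists_orthonormalBasis_polar_eq_zero
    ((q i).comp (Submodule.inclusion (inf_le_right : W i ≤ V i.castSucc)))
  let B₀ := hint.collectedOrthonormalBasis hortho b
  have hB₀ : ∀ a, B₀ a = (b a.1 a.2 : E) := fun a => by
    simp [B₀, DirectSum.IsInternal.collectedOrthonormalBasis]
  have hcard : Fintype.card (Σ i, Fin (Module.finrank ℝ (W i))) = Fintype.card (Fin n) := by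
    rw [← Module.finrank_eq_card_basis B₀.toBasis, hn, Fintype.card_fin]
  let e := Fintype.equivOfCardEq hcard
  have hB : ∀ j, B₀.reindex e j = (b (e.symm j).1 (e.symm j).2 : E) := fun j => by
    rw [OrthonormalBasis.reindex_apply, hB₀]
  have hBW : ∀ j, B₀.reindex e j ∈ W (e.symm j).1 := fun j => by rw [hB]; exact (b _ _).2
  refine ⟨B₀.reindex e, fun j => (e.symm j).1, fun i v => ⟨fun hv j hj => ?_, fun hv => ?_⟩, ?_⟩
  · rw [real_inner_comm]
    exact (hBW j).1 v (hV (Fin.castSucc_lt_iff_succ_le.1 hj) hv)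
  · rw [← (B₀.reindex e).sum_repr v]
    refine Submodule.sum_mem _ fun j _ => ?_
    by_cases hj : ((e.symm j).1).castSucc < i
    · rw [OrthonormalBasis.repr_apply_apply, hv j hj, zero_smul]; exact zero_mem _
    · exact Submodule.smul_mem _ _ (hV (not_lt.1 hj) (hBW j).2)
  · intro a c hac i ha hc u v hu hv
    obtain ⟨⟨i', a'⟩, rfl⟩ := e.surjective a
    obtain ⟨⟨i'', c'⟩, rfl⟩ := e.surjective c
    simp only [Equiv.symm_apply_apply] at ha hc
    subst ha hc
    have hne : a' ≠ c' := fun h => hac (by rw [h])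
    rw [hB, Equiv.symm_apply_apply] at hu hv
    have h1 := hb i'' a' c' hne
    rw [polar_comp_linearMap] at h1
    rw [← h1]
    congr 1
    · exact Subtype.ext hu
    · exact Subtype.ext hv

variable {n k : ℕ} {F : PartialFlag n k}

/-- Every flag of forms has a frame that a given linear map takes to an orthonormal frame. -/
lemma exists_isFrame_orthogonal (β : FlagOfForms F) (C : GL (Fin n) ℝ) :
    ∃ (A : GL (Fin n) ℝ) (l : Fin n → Fin (k + 1)) (w : Fin n → ℝ), IsFrame β A l w ∧
      (C * A).1ᵀ * (C * A).1 = 1 := by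
  classical
  -- Pulling back by `C⁻¹` moves the flag and the forms by `C` into Euclidean space. If `K` is the
  -- matrix of an adapted orthonormal basis there, then `A = C⁻¹ K` is a frame and `C A = K`.
  let ψ : EuclideanSpace ℝ (Fin n) →ₗ[ℝ] (Fin n → ℝ) :=
    Matrix.toLin' C⁻¹.1 ∘ₗ (WithLp.linearEquiv 2 ℝ (Fin n → ℝ)).toLinearMap
  have hψ : ∀ v : EuclideanSpace ℝ (Fin n), ψ v = C⁻¹.1 *ᵥ (WithLp.ofLp v) := fun v => rfl
  obtain ⟨B, l, hVB, hpol⟩ := exists_orthonormalBasis_adapted (finrank_euclideanSpace_fin (n := n))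
    (fun i => (F.V i).comap ψ) (fun i j hij => Submodule.comap_mono (F.strictAnti.antitone hij))
    (by rw [F.zero_eq, Submodule.comap_top])
    (by
      rw [F.last_eq, Submodule.comap_bot, LinearMap.ker_eq_bot']
      intro v hv
      have h1 : C.1 *ᵥ ψ v = WithLp.ofLp v := by rw [hψ, mulVec_inv_mulVec]
      rw [hv, Matrix.mulVec_zero] at h1
      exact WithLp.ofLp_injective 2 h1.symm)
    (fun i => (β.pullback i).comp (ψ.restrict fun v hv => hv))
  let K : Matrix (Fin n) (Fin n) ℝ := Matrix.of fun i j => B j i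
  have hK : Kᵀ * K = 1 := by
    ext i j
    have h1 := orthonormal_iff_ite.1 B.orthonormal i j
    rw [PiLp.inner_apply] at h1
    rw [Matrix.mul_apply, Matrix.one_apply, ← h1]
    exact Finset.sum_congr rfl fun c _ => mul_comm _ _
  let KG : GL (Fin n) ℝ := ⟨K, Kᵀ, mul_eq_one_comm.1 hK, hK⟩
  have hKx : ∀ x, WithLp.toLp 2 (K *ᵥ x) = ∑ j, x j • B j := by
    intro x
    ext i
    simp [Matrix.mulVec, dotProduct, K, mul_comm]
  have hA : ∀ x, (C⁻¹ * KG).1 *ᵥ x = ψ (WithLp.toLp 2 (K *ᵥ x)) := by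
    intro x
    rw [hψ, Units.val_mul, Matrix.mulVec_mulVec]
  have hflag : IsFlagFrame F (C⁻¹ * KG) l := by
    intro i x
    rw [hA]
    refine (hVB i _).trans ?_
    refine forall_congr' fun j => imp_congr_right fun _ => ?_
    rw [hKx, B.orthonormal.inner_right_fintype]
  have hsingle : ∀ j, (C⁻¹ * KG).1 *ᵥ Pi.single j 1 = ψ (B j) := by
    intro j
    rw [hA, hKx]
    congr 1
    rw [Finset.sum_eq_single j (fun c _ hc => by simp [hc]) (by simp)]
    simp
  obtain ⟨w, hw⟩ := hflag.exists_isFrame (β := β) fun a c hac hlac => by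
    have ha := hflag.single_mem a
    have hc : (C⁻¹ * KG).1 *ᵥ Pi.single c 1 ∈ F.V (l a).castSucc := hlac ▸ hflag.single_mem c
    have h1 := hpol a c hac _ rfl hlac ⟨B a, by rw [hsingle] at ha; exact ha⟩
      ⟨B c, by rw [hsingle] at hc; exact hc⟩ rfl rfl
    rw [polar_comp_linearMap] at h1
    rw [← h1]
    congr 1
    · exact Subtype.ext (hsingle a)
    · exact Subtype.ext (hsingle c)
  refine ⟨C⁻¹ * KG, l, w, hw, ?_⟩
  rw [mul_inv_cancel_left]
  exact hK

end OrthonormalFrames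

end PartialFlagGeometry

namespace PartialFlagGeometry

/-! ### Limits of moved frames along an ultrafilter -/

section Limits

/-- A total preorder on a finite type is pulled back from a surjection onto some `Fin (k + 1)`. -/
lemma exists_rank {ι : Type*} [Fintype ι] [Nonempty ι] (le : ι → ι → Prop)
    (total : ∀ a b, le a b ∨ le b a) (trans : ∀ a b c, le a b → le b c → le a c) :
    ∃ (k : ℕ) (r : ι → Fin (k + 1)), Function.Surjective r ∧ ∀ a b, r a ≤ r b ↔ le a b := by
  classical
  -- By totality, `f a` counts the elements strictly below `a`. Its values represent the preorder,
  -- and enumerating the image makes them consecutive.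
  let f : ι → ℕ := fun a => (Finset.univ.filter fun b => ¬ le a b).card
  have hf : ∀ a b, f a ≤ f b ↔ le a b := by
    intro a b
    constructor
    · intro h
      by_contra hab
      refine (Finset.card_lt_card (Finset.ssubset_iff_subset_ne.2 ⟨fun c hc => ?_, ?_⟩)).not_ge h
      · rw [Finset.mem_filter] at hc ⊢
        exact ⟨hc.1, fun h' => hc.2 (trans _ _ _ ((total a b).resolve_left hab) h')⟩
      · intro he
        have : b ∈ Finset.univ.filter fun c => ¬ le a c := by simpa using hab
        rw [← he] at this
        exact (Finset.mem_filter.1 this).2 ((total b b).elim id id)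
    · intro h
      refine Finset.card_le_card fun c hc => ?_
      rw [Finset.mem_filter] at hc ⊢
      exact ⟨hc.1, fun h' => hc.2 (trans _ _ _ h h')⟩
  let S := Finset.univ.image f
  have hS : S.card ≠ 0 := by
    rw [Finset.card_ne_zero]
    exact Finset.univ_nonempty.image f
  obtain ⟨k, hk⟩ := Nat.exists_eq_succ_of_ne_zero hS
  let e := S.orderIsoOfFin hk
  have hmem : ∀ a, f a ∈ S := fun a => Finset.mem_image_of_mem f (Finset.mem_univ a)
  refine ⟨k, fun a => e.symm ⟨f a, hmem a⟩, fun i => ?_, fun a b => ?_⟩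
  · obtain ⟨a, -, ha⟩ := Finset.mem_image.1 (e i).2
    exact ⟨a, by rw [OrderIso.symm_apply_eq]; exact Subtype.ext ha⟩
  · rw [e.symm.le_iff_le, Subtype.mk_le_mk, hf]

variable {n k : ℕ}

/-- Along an ultrafilter, diagonal forms degenerate to diagonal forms. -/
lemma exists_degenerates {κ : Type*} (hn : n ≠ 0) (U : Ultrafilter κ) (l : Fin n → Fin (k + 1))
    (w : κ → Fin n → ℝ) (hw : ∀ m a, w m a ≠ 0) :
    ∃ (k' : ℕ) (l' : Fin n → Fin (k' + 1)) (w' : Fin n → ℝ), Function.Surjective l' ∧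
      Degenerates (U : Filter κ) l w l' w' ∧
      ∀ᶠ m in (U : Filter κ), ∀ a, (w m a < 0 ↔ w' a < 0) ∧ (0 < w m a ↔ 0 < w' a) := by
  have : Nonempty (Fin n) := ⟨⟨0, Nat.pos_of_ne_zero hn⟩⟩
  obtain ⟨k', l', hl', hle⟩ := exists_rank
    -- Within an old level, `a` precedes `b` when the weight of `b` is bounded by a multiple of that
    -- of `a` along `U`; heavier weights come first. Totality uses that `U` is an ultrafilter.
    (fun a b : Fin n => l a < l b ∨ (l a = l b ∧
      ∃ C : ℝ, ∀ᶠ m in (U : Filter κ), |w m b| ≤ C * |w m a|))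
    (by
      intro a b
      rcases lt_trichotomy (l a) (l b) with h | h | h
      · exact .inl (.inl h)
      · by_cases hC : ∀ᶠ m in (U : Filter κ), |w m b| ≤ 1 * |w m a|
        · exact .inl (.inr ⟨h, 1, hC⟩)
        · refine .inr (.inr ⟨h.symm, 1, ?_⟩)
          filter_upwards [Ultrafilter.eventually_not.2 hC] with m hm
          linarith
      · exact .inr (.inl h))
    (by
      rintro a b c (h | ⟨h, C, hC⟩) (h' | ⟨h', D, hD⟩)
      · exact .inl (h.trans h')
      · exact .inl (h.trans_eq h')
      · exact .inl (h.trans_lt h')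
      · refine .inr ⟨h.trans h', |D| * C, ?_⟩
        filter_upwards [hC, hD] with m h1 h2
        calc |w m c| ≤ D * |w m b| := h2
          _ ≤ |D| * |w m b| := by gcongr; exact le_abs_self D
          _ ≤ |D| * (C * |w m a|) := by gcongr
          _ = |D| * C * |w m a| := by ring)
  choose r hr using hl'
  have hbd : ∀ a b, l' a = l' b → ∃ C : ℝ, ∀ᶠ m in (U : Filter κ), |w m b / w m a| ≤ C := by
    intro a b hab
    rcases (hle a b).1 hab.le with h | ⟨-, C, hC⟩
    · rcases (hle b a).1 hab.ge with h' | ⟨h', -⟩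
      · exact absurd h h'.asymm
      · exact absurd h h'.not_gt
    · refine ⟨C, ?_⟩
      filter_upwards [hC] with m hm
      rw [abs_div, div_le_iff₀ (abs_pos.2 (hw m a))]
      exact hm
  have hlim : ∀ a b, l' a = l' b → ∃ c : ℝ, c ≠ 0 ∧
      Tendsto (fun m => w m b / w m a) U (𝓝 c) := by
    have hex : ∀ a b, l' a = l' b → ∃ c : ℝ, Tendsto (fun m => w m b / w m a) U (𝓝 c) := by
      intro a b hab
      obtain ⟨C, hC⟩ := hbd a b hab
      have hmem : (U.map fun m => w m b / w m a : Filter ℝ) ≤ 𝓟 (Set.Icc (-C) C) := by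
        rw [Filter.le_principal_iff]
        change ∀ᶠ m in (U : Filter κ), w m b / w m a ∈ Set.Icc (-C) C
        filter_upwards [hC] with m hm using abs_le.1 hm
      obtain ⟨c, -, hc⟩ := isCompact_iff_ultrafilter_le_nhds.1 (isCompact_Icc (a := -C) (b := C)) _
        hmem
      exact ⟨c, hc⟩
    intro a b hab
    obtain ⟨c, hc⟩ := hex a b hab
    obtain ⟨d, hd⟩ := hex b a hab.symm
    -- The reciprocal ratio converges too and the product of the two is `1`, so neither limit is
    -- zero.
    refine ⟨c, fun h0 => ?_, hc⟩
    have h1 := hc.mul hd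
    have h2 : Tendsto (fun m => w m b / w m a * (w m a / w m b)) U (𝓝 1) := by
      refine tendsto_const_nhds.congr fun m => ?_
      rw [div_mul_div_cancel₀ (hw m a), div_self (hw m b)]
    have := tendsto_nhds_unique h1 h2
    rw [h0, zero_mul] at this
    exact zero_ne_one this
  -- Dividing by the absolute value of one reference weight per new level preserves the signs of the
  -- weights.
  have hex : ∀ a, ∃ c : ℝ, c ≠ 0 ∧ Tendsto (fun m => w m a / |w m (r (l' a))|) U (𝓝 c) := by
    intro a
    obtain ⟨c, hc0, hc⟩ := hlim (r (l' a)) a (hr _)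
    by_cases hs : ∀ᶠ m in (U : Filter κ), 0 < w m (r (l' a))
    · refine ⟨c, hc0, hc.congr' ?_⟩
      filter_upwards [hs] with m hm
      rw [abs_of_pos hm]
    · refine ⟨-c, neg_ne_zero.2 hc0, hc.neg.congr' ?_⟩
      filter_upwards [Ultrafilter.eventually_not.2 hs] with m hm
      rw [abs_of_nonpos (not_lt.1 hm), div_neg]
  choose w' hw'0 hw' using hex
  refine ⟨k', l', w', fun i => ⟨r i, hr i⟩, ⟨hw, hw'0, fun a b hab => ?_, fun a b hab hab' => ?_,
    fun a b hab => ?_⟩, ?_⟩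
  · rw [← not_le, hle]
    rintro (h | ⟨h, -⟩)
    · exact h.asymm hab
    · exact hab.ne h.symm
  · rw [← not_le, hle] at hab'
    push Not at hab'
    have h1 := hab'.2 hab.symm
    rw [Metric.tendsto_nhds]
    intro ε hε
    filter_upwards [h1 ε⁻¹] with m hm
    rw [Real.dist_eq, sub_zero, abs_div, div_lt_iff₀ (abs_pos.2 (hw m a))]
    have := mul_lt_mul_of_pos_left hm hε
    rwa [mul_inv_cancel_left₀ hε.ne'] at this
  · refine ((hw' b).div (hw' a) (hw'0 a)).congr fun m => ?_
    rw [Pi.div_apply, hab, div_div_div_cancel_right₀ (abs_ne_zero.2 (hw m _))]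
  · rw [eventually_all]
    intro a
    have hpos : ∀ m, 0 < |w m (r (l' a))| := fun m => abs_pos.2 (hw m _)
    rcases (hw'0 a).lt_or_gt with h | h
    · filter_upwards [(hw' a).eventually_lt_const h] with m hm
      have : w m a < 0 := by
        by_contra h'
        exact hm.not_ge (div_nonneg (not_lt.1 h') (hpos m).le)
      exact ⟨iff_of_true this h, iff_of_false this.not_gt h.not_gt⟩
    · filter_upwards [(hw' a).eventually_const_lt h] with m hm
      have : 0 < w m a := by
        by_contra h'
        exact hm.not_ge (div_nonpos_of_nonpos_of_nonneg (not_lt.1 h') (hpos m).le)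
      exact ⟨iff_of_false this.not_gt h.not_gt, iff_of_true this h⟩

/-- The entries lie in `[-1, 1]`, the equation `gᵀ g = 1` is closed, and the inverses converge
because they are transposes. -/
lemma exists_tendsto_of_orthogonal {κ : Type*} (U : Ultrafilter κ) (g : κ → GL (Fin n) ℝ)
    (hg : ∀ m, (g m).1ᵀ * (g m).1 = 1) : ∃ g₀, Tendsto g U (𝓝 g₀) := by
  have hcomp : IsCompact (Set.matrix (Set.Icc (-1 : ℝ) 1) : Set (Matrix (Fin n) (Fin n) ℝ)) :=
    isCompact_Icc.matrix
  have hmem : (U.map fun m => (g m).1 : Filter (Matrix (Fin n) (Fin n) ℝ)) ≤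
      𝓟 (Set.matrix (Set.Icc (-1 : ℝ) 1)) := by
    rw [Filter.le_principal_iff]
    change ∀ᶠ m in (U : Filter κ), (g m).1 ∈ Set.matrix (Set.Icc (-1 : ℝ) 1)
    refine Filter.Eventually.of_forall fun m i j => ?_
    have h1 := congrFun (congrFun (hg m) j) j
    rw [Matrix.mul_apply, Matrix.one_apply_eq] at h1
    have h2 : (g m).1 i j * (g m).1 i j ≤ 1 := by
      rw [← h1]
      exact Finset.single_le_sum (f := fun c => (g m).1ᵀ j c * (g m).1 c j)
        (fun c _ => mul_self_nonneg _) (Finset.mem_univ i)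
    exact abs_le.1 (abs_le_one_iff_mul_self_le_one.2 h2)
  obtain ⟨K, -, hK⟩ := isCompact_iff_ultrafilter_le_nhds.1 hcomp _ hmem
  have hlim : Tendsto (fun m => (g m).1) U (𝓝 K) := hK
  have hlimT : Tendsto (fun m => (g m).1ᵀ) U (𝓝 Kᵀ) :=
    (continuous_id.matrix_transpose.tendsto K).comp hlim
  have hKK : Kᵀ * K = 1 :=
    tendsto_nhds_unique (hlimT.mul hlim) (tendsto_const_nhds.congr fun m => (hg m).symm)
  refine ⟨⟨K, Kᵀ, mul_eq_one_comm.1 hKK, hKK⟩, tendsto_units_iff.2 ⟨hlim, ?_⟩⟩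
  refine hlimT.congr fun m => ?_
  rw [Matrix.coe_units_inv]
  exact (Matrix.inv_eq_left_inv (hg m)).symm

variable {F : PartialFlag n k}

/-- Frames of a flag of forms, moved by a sequence of linear maps, degenerate along an
ultrafilter. -/
lemma exists_isFrame_degenerates {κ : Type*} (β : FlagOfForms F) (U : Ultrafilter κ)
    (C : κ → GL (Fin n) ℝ) :
    ∃ (A : κ → GL (Fin n) ℝ) (l : Fin n → Fin (k + 1)) (w : κ → Fin n → ℝ) (k' : ℕ)
      (l' : Fin n → Fin (k' + 1)) (w' : Fin n → ℝ) (K : GL (Fin n) ℝ),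
      (∀ᶠ m in (U : Filter κ), IsFrame β (A m) l (w m)) ∧ Function.Surjective l' ∧
      Degenerates (U : Filter κ) l w l' w' ∧ Tendsto (fun m => C m * A m) U (𝓝 K) ∧
      ∀ᶠ m in (U : Filter κ), ∀ a, (w m a < 0 ↔ w' a < 0) ∧ (0 < w m a ↔ 0 < w' a) := by
  choose A l w hA hO using fun m => exists_isFrame_orthogonal β (C m)
  -- There are finitely many level functions, so the chosen one is constant along `U`.
  obtain ⟨l₀, hl₀⟩ : ∃ l₀, ∀ᶠ m in (U : Filter κ), l m = l₀ := by
    obtain ⟨l₀, h⟩ := Ultrafilter.eq_pure_of_finite (U.map l)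
    refine ⟨l₀, ?_⟩
    have : {l₀} ∈ U.map l := by rw [h]; exact Set.mem_singleton l₀
    exact this
  obtain ⟨k', l', w', hl', hD, hs⟩ := exists_degenerates F.ne_zero U l₀ w fun m => (hA m).ne_zero
  obtain ⟨K, hK⟩ := exists_tendsto_of_orthogonal U _ hO
  refine ⟨A, l₀, w, k', l', w', K, ?_, hl', hD, hK, hs⟩
  filter_upwards [hl₀] with m hm
  rw [← hm]
  exact hA m

end Limits

end PartialFlagGeometry

namespace PartialFlagGeometry

/-! ### What the isometry group determines -/

section Uniqueness

variable {ι α α' : Type*} [Fintype ι] [DecidableEq ι] [LinearOrder α] [LinearOrder α']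
  {l : ι → α} {w : ι → ℝ} {l' : ι → α'} {w' : ι → ℝ}

/-- Test on the transvection with entry `1` at `(b, a)`. If `l' b < l' a` that entry would have to
vanish; if `l' a = l' b` it would have to match the `(a, b)` entry of the inverse, which is `0`. -/
lemma lt_of_diagIsom_le (hw' : ∀ a, w' a ≠ 0) (h : diagIsom l w ≤ diagIsom l' w') {a b : ι}
    (hab : l a < l b) : l' a < l' b := by
  have hne : b ≠ a := fun e => hab.ne (e ▸ rfl)
  let g : GL ι ℝ := ⟨Matrix.transvection b a 1, Matrix.transvection b a (-1),
    by rw [Matrix.transvection_mul_transvection_same b a hne, add_neg_cancel, Matrix.transvection_zero],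
    by rw [Matrix.transvection_mul_transvection_same b a hne, neg_add_cancel, Matrix.transvection_zero]⟩
  have hfil : ∀ c, IsFiltered l (Matrix.transvection b a c) := by
    intro c i j hij
    have h1 : i ≠ j := fun e => hij.ne (e ▸ rfl)
    have h2 : ¬ (b = i ∧ a = j) := by
      rintro ⟨rfl, rfl⟩
      exact hij.not_gt hab
    rw [Matrix.transvection, Matrix.add_apply, Matrix.one_apply_ne h1, Matrix.single_apply,
      if_neg h2, add_zero]
  have hsame : ∀ c i j, l i = l j → Matrix.transvection b a c i j = (1 : Matrix ι ι ℝ) i j := by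
    intro c i j hij
    have h2 : ¬ (b = i ∧ a = j) := by
      rintro ⟨rfl, rfl⟩
      exact hab.ne' hij
    rw [Matrix.transvection, Matrix.add_apply, Matrix.single_apply, if_neg h2, add_zero]
  have hg : g ∈ diagIsom l w := by
    refine ⟨hfil 1, hfil (-1), fun i j hij => ?_⟩
    change w i * Matrix.transvection b a 1 i j = w j * Matrix.transvection b a (-1) j i
    rw [hsame _ i j hij, hsame _ j i hij.symm]
    by_cases e : i = j
    · subst e; rfl
    · rw [Matrix.one_apply_ne e, Matrix.one_apply_ne (Ne.symm e), mul_zero, mul_zero]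
  have hgba : g.1 b a = 1 := by
    change Matrix.transvection b a (1 : ℝ) b a = 1
    simp [Matrix.transvection, Matrix.one_apply_ne hne]
  have hgab : g⁻¹.1 a b = 0 := by
    change Matrix.transvection b a (-1 : ℝ) a b = 0
    simp [Matrix.transvection, Matrix.one_apply_ne hne.symm, hne]
  have hg' := h hg
  rcases lt_trichotomy (l' a) (l' b) with h' | h' | h'
  · exact h'
  · have := hg'.adj b a h'.symm
    rw [hgba, hgab, mul_one, mul_zero] at this
    exact absurd this (hw' b)
  · have := hg'.left b a h'
    rw [hgba] at this
    exact absurd this one_ne_zero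

/-- The reflection in `e_a + t e_b` has entries at `(a, b)` and `(b, a)` in the ratio `w b : w a`,
and adjointness for `w'` compares them. The value `t = 2` replaces `t = 1` when `e_a + e_b` is
isotropic. -/
lemma mul_eq_mul_of_diagIsom_le (hw : ∀ a, w a ≠ 0) (h : diagIsom l w ≤ diagIsom l' w')
    {a b : ι} (hab : l a = l b) (hab' : l' a = l' b) : w' a * w b = w' b * w a := by
  by_cases hne : a = b
  · subst hne; rfl
  obtain ⟨t, ht, hq⟩ : ∃ t : ℝ, t ≠ 0 ∧ w a + w b * t ^ 2 ≠ 0 := by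
    by_cases h1 : w a + w b = 0
    · refine ⟨2, two_ne_zero, fun h2 => hw b ?_⟩
      linarith
    · exact ⟨1, one_ne_zero, by simpa using h1⟩
  let u : ι → ℝ := Function.update (Pi.single a 1) b t
  have hua : u a = 1 := by simp [u, Function.update_of_ne hne]
  have hub : u b = t := by simp [u]
  have hu0 : ∀ j, j ≠ a → j ≠ b → u j = 0 := fun j h1 h2 => by simp [u, h1, h2]
  have hsum : ∑ j with l j = l a, w j * u j ^ 2 = w a + w b * t ^ 2 := by
    have hsub : ({a, b} : Finset ι) ⊆ Finset.univ.filter fun j => l j = l a := by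
      intro j hj
      rcases Finset.mem_insert.1 hj with rfl | hj
      · simp
      · rw [Finset.mem_singleton.1 hj]; simp [hab]
    rw [← Finset.sum_subset hsub fun j _ hj => by
      simp only [Finset.mem_insert, Finset.mem_singleton, not_or] at hj
      rw [hu0 j hj.1 hj.2]; ring, Finset.sum_pair hne, hua, hub]
    ring
  obtain ⟨r, hr, hinv, hrv⟩ := exists_reflection (l := l) (w := w) (i := l a) (u := u)
    (fun j hj => hu0 j (fun e => hj.ne (e ▸ rfl)) (fun e => hj.ne (e ▸ hab.symm)))
    (by rw [hsum]; exact hq)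
  have key := (h hr).adj a b hab'
  rw [hinv, hrv, hsum] at key
  simp only [Matrix.sub_apply, Matrix.one_apply_ne hne, Matrix.one_apply_ne (Ne.symm hne),
    Matrix.smul_apply, Matrix.vecMulVec_apply, hab, hua, hub, if_true, smul_eq_mul] at key
  have h3 : (2 / (w a + w b * t ^ 2) * t) * (w' a * w b) =
      (2 / (w a + w b * t ^ 2) * t) * (w' b * w a) := by linarith
  exact mul_left_cancel₀ (mul_ne_zero (div_ne_zero two_ne_zero hq) ht) h3

end Uniqueness

/-! ### Structure of a conjugacy limit -/

section Structure

variable {n k k' : ℕ} {F : PartialFlag n k} {β : FlagOfForms F}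

lemma frameIsom_eq_of_map_mk_eq {α α' : Type*} [LinearOrder α] [LinearOrder α'] (hn : n ≠ 0)
    {A A' : GL (Fin n) ℝ} {l : Fin n → α} {l' : Fin n → α'} {w w' : Fin n → ℝ}
    (hw : ∀ a, w a ≠ 0) (hw' : ∀ a, w' a ≠ 0)
    (h : (frameIsom A l w).map Matrix.ProjGenLinGroup.mk =
      (frameIsom A' l' w').map Matrix.ProjGenLinGroup.mk) :
    frameIsom A l w = frameIsom A' l' w' := by
  ext g
  constructor
  · intro hg
    exact mem_frameIsom_of_mk_mem hn hw' (sq_det_of_mem_frameIsom hw hg) (h ▸ ⟨g, hg, rfl⟩)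
  · intro hg
    exact mem_frameIsom_of_mk_mem hn hw (sq_det_of_mem_frameIsom hw' hg) (h ▸ ⟨g, hg, rfl⟩)

lemma IsFrame.map_conj_pIsom {A : GL (Fin n) ℝ} {l : Fin n → Fin (k + 1)} {w : Fin n → ℝ}
    (h : IsFrame β A l w) (C : GL (Fin n) ℝ) :
    β.pIsom.map (MulAut.conj (Matrix.ProjGenLinGroup.mk C)).toMonoidHom =
      (frameIsom (C * A) l w).map Matrix.ProjGenLinGroup.mk := by
  rw [h.pIsom_eq, frameIsom, frameIsom, Subgroup.map_map, Subgroup.map_map, Subgroup.map_map]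
  congr 1
  ext g
  simp [mul_assoc]

/-- The structure of a conjugacy limit. -/
lemma IsConjugacyLimit.exists_frames {Z : Set (ℙ ℝ (Fin n → ℝ))} {L : Subgroup (PGL(n, ℝ))}
    (h : IsConjugacyLimit β.domain β.pIsom Z L) :
    ∃ (A : GL (Fin n) ℝ) (l : Fin n → Fin (k + 1)) (w : Fin n → ℝ) (k' : ℕ)
      (l' : Fin n → Fin (k' + 1)) (w' : Fin n → ℝ) (K : GL (Fin n) ℝ),
      IsFrame β A l w ∧ Function.Surjective l' ∧ (∀ a, w' a ≠ 0) ∧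
      (∀ a b, l a < l b → l' a < l' b) ∧
      (∀ a, (w a < 0 ↔ w' a < 0) ∧ (0 < w a ↔ 0 < w' a)) ∧
      L = (frameIsom K l' w').map Matrix.ProjGenLinGroup.mk ∧
      ∃ (x : Fin n → ℝ) (hx : x ≠ 0), topForm l' w' x < 0 ∧
        Projectivization.mk ℝ (K.1 *ᵥ x) (mulVec_ne_zero K hx) ∈ Z := by
  obtain ⟨hsub, c, hconv, z, hz, hzY⟩ := h
  choose C hC using fun m => Matrix.ProjGenLinGroup.mk_surjective (c m)
  -- A nonprincipal ultrafilter plays the role of all the successive subsequences.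
  let U := hyperfilter ℕ
  have hU : (U : Filter ℕ) ≤ atTop := Nat.hyperfilter_le_atTop
  obtain ⟨A, l, w, k', l', w', K, hA, hl', hD, hK, hs⟩ := exists_isFrame_degenerates β U C
  have hL : L = (frameIsom K l' w').map Matrix.ProjGenLinGroup.mk := by
    refine hconv.eq_map_frameIsom F.ne_zero hU hD hK ?_
    filter_upwards [hA] with m hm
    rw [← hC m, hm.map_conj_pIsom]
  obtain ⟨m₀, hm₀, hm₀s⟩ := (hA.and hs).exists
  obtain ⟨x, hx, rfl⟩ := exists_mk_mulVec K z
  obtain ⟨a₀, ha₀⟩ := hl' 0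
  have hl0 : ∀ b, l' b = 0 → l b = 0 := by
    intro b hb
    obtain ⟨b', hb'⟩ := hm₀.flag.surjective 0
    by_contra hne
    have := hD.lt b' b (by rw [hb']; exact Fin.pos_of_ne_zero hne)
    rw [hb] at this
    exact absurd this (Fin.not_lt_zero _)
  refine ⟨A m₀, l, w m₀, k', l', w', K, hm₀, hl', hD.ne_zero', hD.lt, hm₀s, hL, x, hx, ?_, hz⟩
  -- The coordinates of the common point in the moved frames; they converge to its coordinates `x`
  -- in the frame `K`.
  let y : ℕ → Fin n → ℝ := fun m => (C m * A m)⁻¹.1 *ᵥ (K.1 *ᵥ x)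
  have hy : Tendsto y U (𝓝 x) := by
    have h1 : Tendsto (fun m => (C m * A m)⁻¹.1) U (𝓝 K⁻¹.1) := (tendsto_units_iff.1 hK).2
    have h2 : Continuous fun M : Matrix (Fin n) (Fin n) ℝ => M *ᵥ (K.1 *ᵥ x) := by fun_prop
    have := (h2.tendsto _).comp h1
    rwa [inv_mulVec_mulVec] at this
  have hneg : ∀ᶠ m in (U : Filter ℕ), topForm l (w m) (y m) < 0 := by
    filter_upwards [hA, hU hzY] with m hm hmY
    obtain ⟨v, hv, hvz⟩ := hmY
    obtain ⟨u, hu, rfl⟩ := exists_mk_mulVec (A m) v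
    rw [hm.mk_mulVec_mem_domain hu] at hv
    simp only [← hC m, Projectivization.PGL.mk_smul_mk] at hvz
    obtain ⟨s, hs⟩ := (Projectivization.mk_eq_mk_iff' ℝ _ _ _ _).1 hvz
    have hs' : s • (K.1 *ᵥ x) = (C m).1 *ᵥ ((A m).1 *ᵥ u) := hs
    have h3 : s • y m = u := by
      have := congrArg (fun t => (C m * A m)⁻¹.1 *ᵥ t) hs'
      simp only [Matrix.mulVec_smul] at this
      rw [Matrix.mulVec_mulVec (v := u), ← Units.val_mul, inv_mulVec_mulVec] at this
      exact this
    rw [← h3, topForm_smul] at hv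
    by_contra hcon
    exact hv.not_ge (mul_nonneg (sq_nonneg s) (not_lt.1 hcon))
  -- Normalized by the weight of an index `a₀` of top `l'`-level, the top forms converge to the
  -- limiting one: the lighter terms of old level `0` disappear. Since `w m a₀` and `w' a₀` have the
  -- same sign, nonpositivity survives.
  have hlim : Tendsto (fun m => w' a₀ * (topForm l (w m) (y m) / w m a₀)) U
      (𝓝 (topForm l' w' x)) := by
    have hy' : ∀ j, Tendsto (fun m => y m j) U (𝓝 (x j)) := tendsto_pi_nhds.1 hy
    have e1 : ∀ m, w' a₀ * (topForm l (w m) (y m) / w m a₀) =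
        ∑ j with l j = 0, w' a₀ * (w m j / w m a₀ * y m j ^ 2) := by
      intro m
      rw [topForm, Finset.sum_div, Finset.mul_sum]
      exact Finset.sum_congr rfl fun j _ => by ring
    have e2 : topForm l' w' x = ∑ j with l j = 0, if l' j = 0 then w' j * x j ^ 2 else 0 := by
      rw [← Finset.sum_filter, Finset.filter_filter, topForm]
      congr 1
      ext j
      simp only [Finset.mem_filter, Finset.mem_univ, true_and]
      exact ⟨fun h => ⟨hl0 j h, h⟩, fun h => h.2⟩
    simp only [e1, e2]
    refine tendsto_finsetSum _ fun j hj => ?_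
    have hj0 : l j = 0 := (Finset.mem_filter.1 hj).2
    split_ifs with hj'
    · have := ((hD.tendsto a₀ j (ha₀.trans hj'.symm)).mul ((hy' j).pow 2)).const_mul (w' a₀)
      convert this using 2
      field_simp [hD.ne_zero' a₀]
    · have := ((hD.tendsto_zero a₀ j ((hl0 a₀ ha₀).trans hj0.symm)
        (by rw [ha₀]; exact Fin.pos_of_ne_zero hj')).mul ((hy' j).pow 2)).const_mul (w' a₀)
      simpa using this
  have hle : topForm l' w' x ≤ 0 := by
    refine le_of_tendsto hlim ?_
    filter_upwards [hneg, hs] with m h1 h2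
    rcases (hD.ne_zero' a₀).lt_or_gt with h3 | h3
    · exact mul_nonpos_of_nonpos_of_nonneg h3.le
        (div_nonneg_of_nonpos h1.le ((h2 a₀).1.2 h3).le)
    · exact mul_nonpos_of_nonneg_of_nonpos h3.le
        (div_nonpos_of_nonpos_of_nonneg h1.le ((h2 a₀).2.2 h3).le)
  refine hle.lt_of_ne fun h0 => ?_
  -- Were the value zero, transitivity of `L` would make the form vanish on all of `Z`. As `Z` is
  -- open, it would vanish at `x + t e_{a₀}` for all small `t`; adding the values at `t` and `-t`
  -- leaves `2 * t ^ 2 * w' a₀`, a contradiction.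
  have hvanish : ∀ (x' : Fin n → ℝ) (hx' : x' ≠ 0),
      Projectivization.mk ℝ (K.1 *ᵥ x') (mulVec_ne_zero K hx') ∈ Z → topForm l' w' x' = 0 := by
    intro x' hx' hmem
    obtain ⟨g, hg, hgz⟩ := hsub.transitive _ hz _ hmem
    rw [hL] at hg
    obtain ⟨_, ⟨r, hr, rfl⟩, rfl⟩ := hg
    change (Matrix.ProjGenLinGroup.mk (K * r * K⁻¹) : PGL(n, ℝ)) • _ = _ at hgz
    rw [mk_smul_mk_mulVec _ _ hx] at hgz
    obtain ⟨s, hs⟩ := (Projectivization.mk_eq_mk_iff' ℝ _ _ _ _).1 hgz.symm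
    rw [← Matrix.mulVec_smul] at hs
    have h1 : s • (r.1 *ᵥ x) = x' := by
      rw [← inv_mulVec_mulVec K x', ← hs, inv_mulVec_mulVec]
    rw [← h1, topForm_smul, topForm_mulVec hr, h0, mul_zero]
  let f : ℝ → Fin n → ℝ := fun t => x + t • Pi.single a₀ 1
  have hf : Continuous f := by fun_prop
  have hfZ : ∀ᶠ t in 𝓝 (0 : ℝ), topForm l' w' (f t) = 0 := by
    have hopen : IsOpen (Subtype.val '' ((fun v : {v : Fin n → ℝ // v ≠ 0} =>
        Projectivization.mk ℝ v.1 v.2) ⁻¹' Z)) :=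
      isOpen_ne.isOpenMap_subtype_val _ (hsub.isOpen.preimage continuous_projMk)
    have hKf : Continuous fun t => K.1 *ᵥ f t := Continuous.matrix_mulVec continuous_const hf
    have h0mem : K.1 *ᵥ f 0 ∈ Subtype.val '' ((fun v : {v : Fin n → ℝ // v ≠ 0} =>
        Projectivization.mk ℝ v.1 v.2) ⁻¹' Z) :=
      ⟨⟨K.1 *ᵥ x, mulVec_ne_zero K hx⟩, hz, by simp [f]⟩
    filter_upwards [hKf.continuousAt.preimage_mem_nhds (hopen.mem_nhds h0mem)] with t ht
    obtain ⟨⟨v, hv⟩, hvZ, hvt⟩ := ht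
    simp only at hvt
    subst hvt
    have hft : f t ≠ 0 := fun e => hv (by rw [e, Matrix.mulVec_zero])
    exact hvanish (f t) hft hvZ
  have hfZ' : ∀ᶠ t in 𝓝 (0 : ℝ), topForm l' w' (f (-t)) = 0 := by
    have : Tendsto (fun t : ℝ => -t) (𝓝 0) (𝓝 0) := by
      simpa using (continuous_neg (G := ℝ)).tendsto 0
    exact this.eventually hfZ
  obtain ⟨t, ⟨ht1, ht2⟩, ht0⟩ :=
    (((hfZ.and hfZ').filter_mono nhdsWithin_le_nhds).and
      (self_mem_nhdsWithin : {(0 : ℝ)}ᶜ ∈ 𝓝[≠] (0 : ℝ))).exists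
  simp only [f, topForm_add_smul, topForm_single ha₀, h0] at ht1 ht2
  have h4 : t ^ 2 * w' a₀ = 0 := by linarith
  rcases mul_eq_zero.1 h4 with h5 | h5
  · exact ht0 (pow_eq_zero_iff two_ne_zero |>.1 h5)
  · exact hD.ne_zero' a₀ h5

/-- Every conjugacy limit is the geometry of a flag of forms. -/
lemma IsConjugacyLimit.exists_flagOfForms {Z : Set (ℙ ℝ (Fin n → ℝ))}
    {L : Subgroup (PGL(n, ℝ))} (h : IsConjugacyLimit β.domain β.pIsom Z L) :
    ∃ (k' : ℕ) (F' : PartialFlag n k') (β' : FlagOfForms F'), Z = β'.domain ∧ L = β'.pIsom := by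
  obtain ⟨-, -, -, k', l', w', K, -, hl', hw', -, -, hL, x, hx, hneg, hz⟩ := h.exists_frames
  obtain ⟨F', β', hβ'⟩ := exists_isFrame K hl' hw'
  rw [← hβ'.pIsom_eq] at hL
  have hz' := (hβ'.mk_mulVec_mem_domain hx).2 hneg
  -- `Z` and the domain are both the `L`-orbit of the same point.
  refine ⟨k', F', β', Set.ext fun y => ⟨fun hy => ?_, fun hy => ?_⟩, hL⟩
  · obtain ⟨g, hg, rfl⟩ := h.1.transitive _ hz _ hy
    exact smul_mem_domain hβ' (hL ▸ hg) hz'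
  · obtain ⟨g, hg, rfl⟩ := exists_smul_eq hβ' hz' hy
    exact h.1.smul_mem _ (hL ▸ hg) _ hz

end Structure

end PartialFlagGeometry

namespace PartialFlagGeometry

/-! ### Conjugacy limits refine the flag and the signature -/

section Refinement

variable {n k k' : ℕ} {F : PartialFlag n k} {β : FlagOfForms F} {F' : PartialFlag n k'}
  {β' : FlagOfForms F'}

/-- Counting the indices with given properties level by level. -/
lemma card_filter_comp_eq_sum {ι κ : Type*} [Fintype ι] [Fintype κ] [DecidableEq κ] (f : ι → κ)
    (T : κ → Prop) [DecidablePred T] (S : Finset κ) {P Q R : ι → Prop} [DecidablePred P]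
    [DecidablePred Q] [DecidablePred R] (hR : ∀ a, f a ∈ S → (P a ↔ R a))
    (hQ : ∀ a, f a ∉ S → (P a ↔ Q a)) :
    (Finset.univ.filter fun a => T (f a) ∧ P a).card =
      ∑ j with T j, (if j ∈ S then (Finset.univ.filter fun a => f a = j ∧ R a).card
        else (Finset.univ.filter fun a => f a = j ∧ Q a).card) := by
  rw [Finset.card_eq_sum_card_fiberwise (f := f) (t := Finset.univ.filter T)]
  · refine Finset.sum_congr rfl fun j hj => ?_
    have hj' := (Finset.mem_filter.1 hj).2
    split_ifs with hjS
    · congr 1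
      ext a
      simp only [Finset.mem_filter, Finset.mem_univ, true_and]
      exact ⟨fun ⟨⟨_, h2⟩, h3⟩ => ⟨h3, (hR a (h3 ▸ hjS)).1 h2⟩, fun ⟨h3, h2⟩ =>
        ⟨⟨h3 ▸ hj', (hR a (h3 ▸ hjS)).2 h2⟩, h3⟩⟩
    · congr 1
      ext a
      simp only [Finset.mem_filter, Finset.mem_univ, true_and]
      exact ⟨fun ⟨⟨_, h2⟩, h3⟩ => ⟨h3, (hQ a (h3 ▸ hjS)).1 h2⟩, fun ⟨h3, h2⟩ =>
        ⟨⟨h3 ▸ hj', (hQ a (h3 ▸ hjS)).2 h2⟩, h3⟩⟩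
  · intro a ha
    exact Finset.mem_coe.2 (Finset.mem_filter.2
      ⟨Finset.mem_univ _, (Finset.mem_filter.1 (Finset.mem_coe.1 ha)).2.1⟩)

/-- The matrix `A K⁻¹` carries the frame `K` to the frame `A`. Both flags then consist of coordinate
subspaces of one basis, and refinement becomes a comparison of `l` with `l'` and a count of signs.
-/
lemma IsFrame.refinesUpToConj {A K : GL (Fin n) ℝ} {l : Fin n → Fin (k + 1)}
    {l' : Fin n → Fin (k' + 1)} {w w' : Fin n → ℝ} (h : IsFrame β A l w)
    (h' : IsFrame β' K l' w') (hlt : ∀ a b, l a < l b → l' a < l' b)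
    (S : Finset (Fin (k' + 1))) (hS0 : 0 ∉ S)
    (hS : ∀ a, l' a ∈ S → (w a < 0 ↔ 0 < w' a) ∧ (0 < w a ↔ w' a < 0))
    (hS' : ∀ a, l' a ∉ S → (w a < 0 ↔ w' a < 0) ∧ (0 < w a ↔ 0 < w' a)) :
    RefinesUpToConj β' β := by
  classical
  let W : Fin (k' + 2) → Submodule ℝ (Fin n → ℝ) := fun j =>
    (F'.V j).map (Matrix.toLin' (A * K⁻¹).1)
  have hAK : ∀ x, (A * K⁻¹).1 *ᵥ (K.1 *ᵥ x) = A.1 *ᵥ x := fun x => by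
    rw [Matrix.mulVec_mulVec, ← Units.val_mul, inv_mul_cancel_right]
  have hW : ∀ j x, A.1 *ᵥ x ∈ W j ↔ ∀ a, (l' a).castSucc < j → x a = 0 := by
    intro j x
    rw [← h'.flag]
    constructor
    · rintro ⟨v, hv, hvx⟩
      rw [Matrix.toLin'_apply, ← hAK] at hvx
      have := inv_mulVec_mulVec (A * K⁻¹) v
      rw [hvx, inv_mulVec_mulVec] at this
      rwa [this]
    · exact fun hx => ⟨_, hx, by rw [Matrix.toLin'_apply, hAK]⟩
  have hle : ∀ (U V : Submodule ℝ (Fin n → ℝ)),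
      U ≤ V ↔ ∀ x, A.1 *ᵥ x ∈ U → A.1 *ᵥ x ∈ V := by
    intro U V
    refine ⟨fun h x hx => h hx, fun h v hv => ?_⟩
    rw [← mulVec_inv_mulVec A v] at hv ⊢
    exact h _ hv
  have hsingle : ∀ a, A.1 *ᵥ Pi.single a 1 ∈ W (l' a).castSucc := by
    intro a
    rw [hW]
    intro b hb
    refine Pi.single_eq_of_ne ?_ _
    rintro rfl
    exact lt_irrefl _ hb
  have hVsingle : ∀ a i, A.1 *ᵥ Pi.single a 1 ∈ F.V i → i ≤ (l a).castSucc := by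
    intro a i hi
    by_contra hcon
    have := (h.flag _ _).1 hi a (not_le.1 hcon)
    rw [Pi.single_eq_same] at this
    exact one_ne_zero this
  have hmono : ∀ a b, l' a ≤ l' b → l a ≤ l b := fun a b hab =>
    not_lt.1 fun h1 => (hlt b a h1).not_ge hab
  have hWV : ∀ a i, i ≤ (l a).castSucc → W (l' a).castSucc ≤ F.V i := by
    intro a i hi
    rw [hle]
    intro x hx
    rw [h.flag]
    intro b hb
    exact (hW _ _).1 hx b
      (Fin.castSucc_lt_castSucc_iff.2 (hlt b a (Fin.castSucc_lt_castSucc_iff.1 (hb.trans_le hi))))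
  have hcond : ∀ a i, (W (l' a).castSucc ≤ F.V i.castSucc ∧ F.V i.succ < W (l' a).castSucc) ↔
      l a = i := by
    intro a i
    constructor
    · rintro ⟨h1, h2⟩
      refine le_antisymm ?_ (Fin.castSucc_le_castSucc_iff.1 (hVsingle a _ (h1 (hsingle a))))
      by_contra hcon
      exact h2.not_ge (hWV a _ (Fin.succ_le_castSucc_iff.2 (not_le.1 hcon)))
    · rintro rfl
      refine ⟨hWV a _ le_rfl, lt_of_le_not_ge ?_ fun h1 => ?_⟩
      · rw [hle]
        intro x hx
        rw [hW]
        intro b hb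
        refine (h.flag _ _).1 hx b (Fin.castSucc_lt_succ_iff.2 (hmono b a ?_))
        exact (Fin.castSucc_lt_castSucc_iff.1 hb).le
      · exact (hVsingle a _ (h1 (hsingle a))).not_gt Fin.castSucc_lt_succ
  refine ⟨A * K⁻¹, W, S, fun _ => rfl, fun i => ?_, hS0, fun i => ?_⟩
  -- `V i` is cut out at the least `l'`-level among the indices of `l`-level at least `i`; the zero
  -- subspace corresponds to the last index.
  · obtain ⟨j, hj⟩ : ∃ j : Fin (k' + 2), ∀ a, (l' a).castSucc < j ↔ (l a).castSucc < i := by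
      induction i using Fin.lastCases with
      | last => exact ⟨Fin.last _, fun a => iff_of_true (Fin.castSucc_lt_last _)
          (Fin.castSucc_lt_last _)⟩
      | cast i =>
        obtain ⟨b₀, hb₀⟩ := h.flag.surjective i
        obtain ⟨b, hb, hmin⟩ := Finset.exists_min_image (Finset.univ.filter fun b => i ≤ l b) l'
          ⟨b₀, by simp [hb₀]⟩
        simp only [Finset.mem_filter, Finset.mem_univ, true_and] at hb hmin
        refine ⟨(l' b).castSucc, fun a => ?_⟩
        rw [Fin.castSucc_lt_castSucc_iff, Fin.castSucc_lt_castSucc_iff]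
        refine ⟨fun h1 => ?_, fun h1 => hlt a b (h1.trans_le hb)⟩
        by_contra hcon
        exact (hmin a (not_lt.1 hcon)).not_gt h1
    refine ⟨j, ?_⟩
    have : ∀ x, A.1 *ᵥ x ∈ W j ↔ A.1 *ᵥ x ∈ F.V i := by
      intro x
      rw [hW, h.flag]
      exact forall_congr' fun a => by rw [hj]
    exact le_antisymm ((hle _ _).2 fun x => (this x).1) ((hle _ _).2 fun x => (this x).2)
  · simp only [h.p_eq, h.q_eq, h'.p_eq, h'.q_eq, ← hcond _ i]
    let T : Fin (k' + 1) → Prop := fun j =>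
      W j.castSucc ≤ F.V i.castSucc ∧ F.V i.succ < W j.castSucc
    exact ⟨card_filter_comp_eq_sum l' T S (fun a ha => (hS a ha).1) fun a ha => (hS' a ha).1,
      card_filter_comp_eq_sum l' T S (fun a ha => (hS a ha).2) fun a ha => (hS' a ha).2⟩

/-- The flag and the signature of a conjugacy limit are refinements. -/
lemma IsConjugacyLimit.refinesUpToConj
    (h : IsConjugacyLimit β.domain β.pIsom β'.domain β'.pIsom) :
    0 < β'.p 0 ∧ RefinesUpToConj β' β := by
  classical
  obtain ⟨A, l, w, k₂, l₂, w₂, K, hA, hl₂, hw₂, hlt, hs, hL, x, hx, hneg, hz⟩ := h.exists_frames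
  obtain ⟨A₁, l₁, w₁, hA₁, -⟩ := exists_isFrame_orthogonal β' 1
  have e₁ : β'.isom = frameIsom K l₂ w₂ := by
    rw [hA₁.isom_eq]
    refine frameIsom_eq_of_map_mk_eq F.ne_zero hA₁.ne_zero hw₂ ?_
    rw [← hA₁.pIsom_eq, hL]
  -- The frame `K` came from the limiting process, not from `β'`. The group contains all sign
  -- changes in it, so it diagonalizes `β'` as well, and `(l', w')` can be compared with `(l₂, w₂)`.
  obtain ⟨l', w', hK⟩ := exists_isFrame_of_signMatrix_mem (β := β') (A := K) fun s => by
    rw [e₁]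
    exact ⟨_, signMatrix_mem s, rfl⟩
  have e₂ : diagIsom l' w' = diagIsom l₂ w₂ := by
    rw [hK.isom_eq] at e₁
    exact Subgroup.map_injective (MulAut.conj K).injective e₁
  have hlt' : ∀ a b, l₂ a < l₂ b ↔ l' a < l' b := fun a b =>
    ⟨lt_of_diagIsom_le hK.ne_zero e₂.ge, lt_of_diagIsom_le hw₂ e₂.le⟩
  have heq : ∀ a b, l' a = l' b → l₂ a = l₂ b := fun a b hab =>
    le_antisymm (not_lt.1 fun h1 => ((hlt' _ _).1 h1).ne' hab)
      (not_lt.1 fun h1 => ((hlt' _ _).1 h1).ne hab)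
  have hratio : ∀ a b, l' a = l' b → w₂ a * w' b = w₂ b * w' a := fun a b hab =>
    mul_eq_mul_of_diagIsom_le hK.ne_zero e₂.le hab (heq a b hab)
  have hneg' : topForm l' w' x < 0 := (hK.mk_mulVec_mem_domain hx).1 hz
  obtain ⟨a₀, ha₀, hwa₀⟩ : ∃ a, l' a = 0 ∧ w' a < 0 := by
    by_contra hcon
    push Not at hcon
    refine hneg'.not_ge (Finset.sum_nonneg fun j hj => ?_)
    exact mul_nonneg (hcon j (Finset.mem_filter.1 hj).2) (sq_nonneg _)
  have hzero : ∀ j, l₂ j = 0 ↔ l' j = 0 := by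
    have aux : ∀ {m m' : ℕ} (r : Fin n → Fin (m + 1)) (r' : Fin n → Fin (m' + 1)),
        Function.Surjective r' → (∀ a b, r' a < r' b → r a < r b) → ∀ j, r j = 0 → r' j = 0 := by
      intro m m' r r' hr' hrr j hj
      obtain ⟨b, hb⟩ := hr' 0
      by_contra hne
      have := hrr b j (by rw [hb]; exact Fin.pos_of_ne_zero hne)
      rw [hj] at this
      exact absurd this (Fin.not_lt_zero _)
    exact fun j => ⟨aux l₂ l' hK.flag.surjective (fun a b => (hlt' a b).2) j,
      aux l' l₂ hl₂ (fun a b => (hlt' a b).1) j⟩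
  refine ⟨?_, ?_⟩
  · rw [hK.p_eq, Finset.card_pos]
    exact ⟨a₀, by simp [ha₀, hwa₀]⟩
  -- On each level `w₂` is a constant multiple of `w'`. The levels with a negative factor form the
  -- set `S` of exchanges.
  · have hsign : ∀ a b, l' a = l' b → w₂ b * w' b < 0 → w₂ a * w' a < 0 := by
      intro a b hab hb
      have h1 : (w₂ a * w' a) * (w₂ b * w' b) = (w₂ a * w' b) ^ 2 := by
        have := hratio a b hab
        calc (w₂ a * w' a) * (w₂ b * w' b) = (w₂ a * w' b) * (w₂ b * w' a) := by ring
          _ = (w₂ a * w' b) ^ 2 := by rw [← this]; ring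
      have h2 : 0 < (w₂ a * w' b) ^ 2 := by
        have := mul_ne_zero (hw₂ a) (hK.ne_zero b)
        positivity
      by_contra hcon
      exact (h1 ▸ h2).not_ge (mul_nonpos_of_nonneg_of_nonpos (not_lt.1 hcon) hb.le)
    refine hA.refinesUpToConj hK (fun a b hab => (hlt' a b).1 (hlt a b hab))
      (Finset.univ.filter fun j => ∃ a, l' a = j ∧ w₂ a * w' a < 0) ?_ ?_ ?_
    -- On level `0` the two top forms are proportional and both negative at `x`, so the factor is
    -- positive.
    · intro h0
      obtain ⟨a, ha, hwa⟩ := (Finset.mem_filter.1 h0).2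
      have h1 := hsign a₀ a (ha₀.trans ha.symm) hwa
      have h2 : w₂ a₀ * topForm l' w' x = w' a₀ * topForm l₂ w₂ x := by
        rw [topForm, topForm, Finset.mul_sum, Finset.mul_sum]
        have : (Finset.univ.filter fun j => l₂ j = 0) = Finset.univ.filter fun j => l' j = 0 :=
          Finset.filter_congr fun j _ => hzero j
        rw [this]
        refine Finset.sum_congr rfl fun j hj => ?_
        have := hratio a₀ j (ha₀.trans (Finset.mem_filter.1 hj).2.symm)
        linear_combination (x j ^ 2) * this
      have h3 : 0 < w₂ a₀ := by
        by_contra hcon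
        exact h1.not_ge (mul_nonneg_of_nonpos_of_nonpos (not_lt.1 hcon) hwa₀.le)
      have h4 := mul_neg_of_pos_of_neg h3 hneg'
      rw [h2] at h4
      exact h4.not_ge (mul_nonneg_of_nonpos_of_nonpos hwa₀.le hneg.le)
    · intro a ha
      obtain ⟨b, hb, hwb⟩ := (Finset.mem_filter.1 ha).2
      have h1 := hsign a b hb.symm hwb
      rw [(hs a).1, (hs a).2]
      rcases mul_neg_iff.1 h1 with ⟨h2, h3⟩ | ⟨h2, h3⟩
      · exact ⟨iff_of_false h2.not_gt h3.not_gt, iff_of_true h2 h3⟩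
      · exact ⟨iff_of_true h2 h3, iff_of_false h2.not_gt h3.not_gt⟩
    · intro a ha
      have h1 : 0 < w₂ a * w' a := by
        refine lt_of_le_of_ne ?_ (mul_ne_zero (hw₂ a) (hK.ne_zero a)).symm
        by_contra hcon
        exact ha (Finset.mem_filter.2 ⟨Finset.mem_univ _, a, rfl, not_le.1 hcon⟩)
      rw [(hs a).1, (hs a).2]
      rcases mul_pos_iff.1 h1 with ⟨h2, h3⟩ | ⟨h2, h3⟩
      · exact ⟨iff_of_false h2.not_gt h3.not_gt, iff_of_true h2 h3⟩
      · exact ⟨iff_of_true h2 h3, iff_of_false h2.not_gt h3.not_gt⟩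

end Refinement

end PartialFlagGeometry

namespace PartialFlagGeometry

/-! ### Every refinement is a conjugacy limit -/

section Degenerations

variable {n k k' : ℕ} {F : PartialFlag n k} {β : FlagOfForms F} {F' : PartialFlag n k'}
  {β' : FlagOfForms F'}

/-- Permuting and rescaling the vectors of a frame. -/
lemma IsFrame.exists_perm_rescale {A : GL (Fin n) ℝ} {l : Fin n → Fin (k + 1)} {w : Fin n → ℝ}
    (h : IsFrame β A l w) (σ : Equiv.Perm (Fin n)) {d : Fin n → ℝ} (hd : ∀ a, d a ≠ 0) :
    ∃ B : GL (Fin n) ℝ, IsFrame β B (fun a => l (σ a)) (fun a => w (σ a) * d a ^ 2) := by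
  let e : (Fin n → ℝ) ≃ₗ[ℝ] (Fin n → ℝ) :=
    (LinearEquiv.piCongrRight fun a => LinearEquiv.smulOfNeZero ℝ ℝ (d a) (hd a)).trans
      (LinearEquiv.funCongrLeft ℝ ℝ σ.symm)
  have he : ∀ x a, e x (σ a) = d a * x a := fun x a => by
    change d (σ.symm (σ a)) * x (σ.symm (σ a)) = _
    rw [σ.symm_apply_apply]
  let M : GL (Fin n) ℝ := ⟨LinearMap.toMatrix' e.toLinearMap, LinearMap.toMatrix' e.symm.toLinearMap,
    by rw [← LinearMap.toMatrix'_comp]; simp, by rw [← LinearMap.toMatrix'_comp]; simp⟩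
  have hM : ∀ x, (A * M).1 *ᵥ x = A.1 *ᵥ e x := fun x => by
    rw [Units.val_mul, ← Matrix.mulVec_mulVec]
    change A.1 *ᵥ (LinearMap.toMatrix' e.toLinearMap *ᵥ x) = _
    rw [LinearMap.toMatrix'_mulVec]
    rfl
  refine ⟨A * M, fun i x => ?_, fun i x hx => ?_⟩
  · rw [hM, h.flag, ← σ.forall_congr_right]
    refine forall_congr' fun a => imp_congr_right fun _ => ?_
    rw [he, mul_eq_zero, or_iff_right (hd a)]
  · have hx' := hx
    rw [hM] at hx'
    have : (⟨(A * M).1 *ᵥ x, hx⟩ : F.V i.castSucc) = ⟨A.1 *ᵥ e x, hx'⟩ := Subtype.ext (hM x)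
    rw [this, h.pullback, Finset.sum_filter, Finset.sum_filter, ← Equiv.sum_comp σ]
    refine Finset.sum_congr rfl fun a _ => ?_
    rw [he]
    congr 1
    ring

/-- Every term of a refining flag lies in exactly one step of the flag. -/
lemma PartialFlag.exists_step (F : PartialFlag n k)
    {W : Fin (k' + 2) → Submodule ℝ (Fin n → ℝ)} (hW : StrictAnti W) (hW0 : W 0 = ⊤)
    (hWl : W (Fin.last _) = ⊥) (hVW : ∀ i, ∃ j, W j = F.V i) :
    ∃ π : Fin (k' + 1) → Fin (k + 1), Monotone π ∧ π 0 = 0 ∧ ∀ j i,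
      (W j.castSucc ≤ F.V i.castSucc ∧ F.V i.succ < W j.castSucc) ↔ π j = i := by
  choose s hs using hVW
  have hsm : StrictMono s := fun a b hab => hW.lt_iff_gt.1 (by
    rw [hs, hs]; exact F.strictAnti hab)
  have hs0 : s 0 = 0 := hW.injective (by rw [hs, hW0, F.zero_eq])
  have hsl : s (Fin.last _) = Fin.last _ := hW.injective (by rw [hs, hWl, F.last_eq])
  have hex : ∀ j : Fin (k' + 1), ∃ i : Fin (k + 1),
      s i.castSucc ≤ j.castSucc ∧ j.castSucc < s i.succ := by
    intro j
    -- The step containing `W j` is the last `i` whose position `s i` in the finer flag is at most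
    -- `j`.
    obtain ⟨i, hi, hmax⟩ := Finset.exists_max_image
      (Finset.univ.filter fun i : Fin (k + 1) => s i.castSucc ≤ j.castSucc) id
      ⟨0, by simp [hs0]⟩
    simp only [Finset.mem_filter, Finset.mem_univ, true_and, id] at hi hmax
    refine ⟨i, hi, not_le.1 fun hle => ?_⟩
    generalize ht : i.succ = t at hle
    induction t using Fin.lastCases with
    | last => exact (hsl ▸ hle).not_gt (Fin.castSucc_lt_last _)
    | cast t =>
      have h1 : i.castSucc < t.castSucc := ht ▸ Fin.castSucc_lt_succ
      exact (hmax t hle).not_gt (Fin.castSucc_lt_castSucc_iff.1 h1)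
  choose π hπ hπ' using hex
  have hmono : ∀ j j' : Fin (k' + 1), ∀ i i' : Fin (k + 1), j ≤ j' →
      s i.castSucc ≤ j.castSucc → j'.castSucc < s i'.succ → i ≤ i' := by
    intro j j' i i' hj h1 h2
    have := hsm.lt_iff_lt.1 (h1.trans_lt ((Fin.castSucc_le_castSucc_iff.2 hj).trans_lt h2))
    exact Fin.castSucc_lt_succ_iff.1 this
  refine ⟨π, fun j j' hj => hmono j j' _ _ hj (hπ j) (hπ' j'), ?_, fun j i => ?_⟩
  · refine le_antisymm (Fin.castSucc_le_castSucc_iff.1 (hsm.le_iff_le.1 ?_)) (Fin.zero_le _)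
    exact (hπ 0).trans (Fin.zero_le _)
  · rw [← hs, ← hs, hW.le_iff_ge, hW.lt_iff_gt]
    constructor
    · rintro ⟨h1, h2⟩
      exact le_antisymm (hmono j j _ _ le_rfl (hπ j) h2) (hmono j j _ _ le_rfl h1 (hπ' j))
    · rintro rfl
      exact ⟨hπ j, hπ' j⟩

lemma exists_perm_of_card_fiber_eq {ι κ : Type*} [Fintype ι] [DecidableEq κ] {f g : ι → κ}
    (h : ∀ c, (Finset.univ.filter fun a => f a = c).card =
      (Finset.univ.filter fun a => g a = c).card) :
    ∃ σ : Equiv.Perm ι, ∀ a, f (σ a) = g a := by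
  have e : ∀ c, {a // g a = c} ≃ {a // f a = c} := fun c =>
    Fintype.equivOfCardEq (by rw [Fintype.card_subtype, Fintype.card_subtype, h])
  exact ⟨Equiv.ofFiberEquiv e, fun a => Equiv.ofFiberEquiv_map e a⟩

/-- The levels and the signs of a refinement, in suitable frames. -/
lemma RefinesUpToConj.exists_levels (h : RefinesUpToConj β' β) {A₀ K : GL (Fin n) ℝ}
    {l₀ : Fin n → Fin (k + 1)} {l' : Fin n → Fin (k' + 1)} {w₀ w' : Fin n → ℝ}
    (h₀ : IsFrame β A₀ l₀ w₀) (h' : IsFrame β' K l' w') :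
    ∃ (π : Fin (k' + 1) → Fin (k + 1)) (ε : Fin (k' + 1) → ℝ) (σ : Equiv.Perm (Fin n)),
      Monotone π ∧ π 0 = 0 ∧ ε 0 = 1 ∧ (∀ j, ε j ≠ 0) ∧
      (∀ a, l₀ (σ a) = π (l' a)) ∧ ∀ a, 0 < ε (l' a) * w' a / w₀ (σ a) := by
  classical
  obtain ⟨g, W, S, hW, hVW, hS0, hcount⟩ := h
  have hinj : Function.Injective (Matrix.toLin' g.1) := fun x y hxy => by
    rw [Matrix.toLin'_apply, Matrix.toLin'_apply] at hxy
    rw [← inv_mulVec_mulVec g x, hxy, inv_mulVec_mulVec]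
  have hWanti : StrictAnti W := by
    rw [funext hW]
    exact (Submodule.map_strictMono_of_injective hinj).comp_strictAnti F'.strictAnti
  have hW0 : W 0 = ⊤ := by
    rw [hW, F'.zero_eq, Submodule.map_top, LinearMap.range_eq_top]
    exact fun x => ⟨g⁻¹.1 *ᵥ x, by rw [Matrix.toLin'_apply, mulVec_inv_mulVec]⟩
  have hWl : W (Fin.last _) = ⊥ := by rw [hW, F'.last_eq, Submodule.map_bot]
  obtain ⟨π, hπ, hπ0, hcond⟩ := F.exists_step hWanti hW0 hWl hVW
  let ε : Fin (k' + 1) → ℝ := fun j => if j ∈ S then -1 else 1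
  have hεS : ∀ j, j ∈ S → ε j = -1 := fun j hj => if_pos hj
  have hεS' : ∀ j, j ∉ S → ε j = 1 := fun j hj => if_neg hj
  have hε : ∀ j, ε j ≠ 0 := fun j => by
    by_cases hj : j ∈ S
    · rw [hεS j hj]; norm_num
    · rw [hεS' j hj]; norm_num
  have hneg : ∀ i, (Finset.univ.filter fun a => l₀ a = i ∧ w₀ a < 0).card =
      (Finset.univ.filter fun a => π (l' a) = i ∧ ε (l' a) * w' a < 0).card := by
    intro i
    rw [← h₀.p_eq, (hcount i).1, card_filter_comp_eq_sum l' (fun j => π j = i) S (R := fun a => 0 < w' a)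
      (Q := fun a => w' a < 0) (fun a ha => by rw [hεS _ ha]; simp)
      (fun a ha => by rw [hεS' _ ha, one_mul])]
    simp only [hcond, h'.p_eq, h'.q_eq]
  have hpos : ∀ i, (Finset.univ.filter fun a => l₀ a = i ∧ 0 < w₀ a).card =
      (Finset.univ.filter fun a => π (l' a) = i ∧ 0 < ε (l' a) * w' a).card := by
    intro i
    rw [← h₀.q_eq, (hcount i).2, card_filter_comp_eq_sum l' (fun j => π j = i) S (R := fun a => w' a < 0)
      (Q := fun a => 0 < w' a) (fun a ha => by rw [hεS _ ha]; simp)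
      (fun a ha => by rw [hεS' _ ha, one_mul])]
    simp only [hcond, h'.p_eq, h'.q_eq]
  have hne : ∀ a, ε (l' a) * w' a ≠ 0 := fun a => mul_ne_zero (hε _) (h'.ne_zero a)
  have hnot : ∀ x : ℝ, x ≠ 0 → (¬ x < 0 ↔ 0 < x) := fun x hx =>
    ⟨fun h => lt_of_le_of_ne (not_lt.1 h) hx.symm, fun h => h.not_gt⟩
  -- The signature identities say that each pair (level, sign) occurs equally often on both sides,
  -- so a permutation matches the indices.
  obtain ⟨σ, hσ⟩ := exists_perm_of_card_fiber_eq (f := fun a => (l₀ a, decide (w₀ a < 0)))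
    (g := fun a => (π (l' a), decide (ε (l' a) * w' a < 0))) (by
      rintro ⟨i, b⟩
      cases b
      · simpa only [Prod.mk.injEq, decide_eq_false_iff_not, hnot _ (hne _),
          hnot _ (h₀.ne_zero _)] using hpos i
      · simpa only [Prod.mk.injEq, decide_eq_true_eq] using hneg i)
  simp only [Prod.mk.injEq, decide_eq_decide] at hσ
  refine ⟨π, ε, σ, hπ, hπ0, hεS' 0 hS0, hε, fun a => (hσ a).1, fun a => ?_⟩
  have h1 := (hσ a).2
  rcases lt_or_gt_of_ne (hne a) with h2 | h2
  · exact div_pos_of_neg_of_neg h2 (h1.2 h2)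
  · exact div_pos h2 ((hnot _ (h₀.ne_zero _)).1 fun h3 => (h1.1 h3).not_gt h2)

/-- Scaling the levels by successive powers of a sequence tending to zero. -/
lemma degenerates_pow {l' : Fin n → Fin (k' + 1)} {w' : Fin n → ℝ} (hw' : ∀ a, w' a ≠ 0)
    {π : Fin (k' + 1) → Fin (k + 1)} (hπ : Monotone π) {ε : Fin (k' + 1) → ℝ}
    (hε : ∀ j, ε j ≠ 0) {δ : ℕ → ℝ} (hδ : ∀ m, δ m ≠ 0) (hδ0 : Tendsto δ atTop (𝓝 0)) :
    Degenerates atTop (fun a => π (l' a)) (fun m a => ε (l' a) * w' a * δ m ^ (l' a : ℕ))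
      l' w' where
  ne_zero m a := mul_ne_zero (mul_ne_zero (hε _) (hw' a)) (pow_ne_zero _ (hδ m))
  ne_zero' := hw'
  lt a b hab := not_le.1 fun h => (hπ h).not_gt hab
  tendsto_zero a b _ hab := by
    obtain ⟨t, ht⟩ := Nat.exists_eq_add_of_lt (Fin.lt_def.1 hab)
    have h1 : Tendsto (fun m => ε (l' b) * w' b / (ε (l' a) * w' a) * δ m ^ (t + 1)) atTop
        (𝓝 0) := by
      simpa using (hδ0.pow (t + 1)).const_mul (ε (l' b) * w' b / (ε (l' a) * w' a))
    refine h1.congr fun m => ?_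
    have := hδ m
    have := hε (l' a)
    have := hw' a
    rw [ht]
    field_simp
    ring
  tendsto a b hab := by
    refine tendsto_const_nhds.congr fun m => ?_
    have := hδ m
    have := hε (l' b)
    have := hw' a
    rw [hab]
    field_simp

/-- Every refinement of the flag and the signature is a conjugacy limit. -/
lemma RefinesUpToConj.isConjugacyLimit (h : RefinesUpToConj β' β) (hp : 0 < β'.p 0) :
    IsConjugacyLimit β.domain β.pIsom β'.domain β'.pIsom := by
  obtain ⟨A₀, l₀, w₀, h₀, -⟩ := exists_isFrame_orthogonal β 1
  obtain ⟨K, l', w', h', -⟩ := exists_isFrame_orthogonal β' 1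
  obtain ⟨π, ε, σ, hπ, hπ0, hε0, hε, hl, hpos⟩ := h.exists_levels h₀ h'
  let δ : ℕ → ℝ := fun m => 1 / ((m : ℝ) + 1)
  have hδ : ∀ m, 0 < δ m := fun m => Nat.one_div_pos_of_nat
  -- The sign `ε` cancels in ratios within a level of `l'`, so the limit does not see the exchanges.
  let w : ℕ → Fin n → ℝ := fun m a => ε (l' a) * w' a * δ m ^ (l' a : ℕ)
  have hD : Degenerates atTop (fun a => π (l' a)) w l' w' :=
    degenerates_pow h'.ne_zero hπ hε (fun m => (hδ m).ne') tendsto_one_div_add_atTop_nhds_zero_nat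
  have hframe : ∀ m, ∃ B, IsFrame β B (fun a => π (l' a)) (w m) := by
    intro m
    -- Rescaling a basis vector multiplies its weight by a square, so `w m` is attained exactly
    -- because its signs agree with those of the permuted `w₀`.
    have hd : ∀ a, 0 < w m a / w₀ (σ a) := fun a => by
      have := mul_pos (hpos a) (pow_pos (hδ m) (l' a : ℕ))
      rwa [div_mul_eq_mul_div] at this
    obtain ⟨B, hB⟩ := h₀.exists_perm_rescale σ
      (d := fun a => √(w m a / w₀ (σ a))) fun a => (Real.sqrt_pos.2 (hd a)).ne'
    refine ⟨B, ?_⟩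
    have h1 : (fun a => w₀ (σ a) * √(w m a / w₀ (σ a)) ^ 2) = w m := funext fun a => by
      rw [Real.sq_sqrt (hd a).le, mul_div_cancel₀ _ (h₀.ne_zero _)]
    rwa [h1, funext hl] at hB
  choose B hB using hframe
  rw [h'.p_eq, Finset.card_pos] at hp
  obtain ⟨a, ha⟩ := hp
  obtain ⟨ha0, hwa⟩ := (Finset.mem_filter.1 ha).2
  have hx : (Pi.single a 1 : Fin n → ℝ) ≠ 0 := by simp
  have hz : Projectivization.mk ℝ (K.1 *ᵥ Pi.single a 1) (mulVec_ne_zero K hx) ∈ β'.domain := by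
    rw [h'.mk_mulVec_mem_domain hx, topForm_single ha0]
    linarith
  -- The conjugating element carries the frame `B m` of `β` to the fixed frame `K`, so only the
  -- weights move.
  refine ⟨h'.isSubgeometry ⟨_, hz⟩, fun m => Matrix.ProjGenLinGroup.mk (K * (B m)⁻¹), ?_, _, hz,
    Eventually.of_forall fun m => ?_⟩
  · have hconj : (fun m => β.pIsom.map
        (MulAut.conj (Matrix.ProjGenLinGroup.mk (K * (B m)⁻¹))).toMonoidHom) =
        fun m => (frameIsom K (fun a => π (l' a)) (w m)).map Matrix.ProjGenLinGroup.mk :=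
      funext fun m => by rw [(hB m).map_conj_pIsom, inv_mul_cancel_right]
    rw [hconj, h'.pIsom_eq]
    exact hD.convergesGeometrically F.ne_zero
  · refine ⟨Projectivization.mk ℝ ((B m).1 *ᵥ Pi.single a 1) (mulVec_ne_zero _ hx), ?_, ?_⟩
    -- On level `0` both the sign and the power of `δ m` are `1`, so this negative basis vector of
    -- `β'` is negative for every `m`.
    · rw [(hB m).mk_mulVec_mem_domain hx, topForm_single (by rw [ha0, hπ0])]
      simp only [w, ha0, hε0]
      simpa using hwa
    · refine (Projectivization.PGL.mk_smul_mk _ _).trans ?_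
      congr 1
      change (K * (B m)⁻¹).1 *ᵥ ((B m).1 *ᵥ Pi.single a 1) = _
      rw [Matrix.mulVec_mulVec, ← Units.val_mul, inv_mul_cancel_right]

end Degenerations

end PartialFlagGeometry

theorem mainTheorem7 {n k : ℕ} (F : PartialFlagGeometry.PartialFlag n k)
    (β : PartialFlagGeometry.FlagOfForms F) :
    -- every conjugacy limit of `(X(β), P Isom(F, β))` is of the form `(X(β'), P Isom(F', β'))`
    (∀ (Z : Set (ℙ ℝ (Fin n → ℝ))) (L : Subgroup (PGL(n, ℝ))),
      PartialFlagGeometry.IsConjugacyLimit β.domain β.pIsom Z L →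
      ∃ (k' : ℕ) (F' : PartialFlagGeometry.PartialFlag n k')
        (β' : PartialFlagGeometry.FlagOfForms F'), Z = β'.domain ∧ L = β'.pIsom) ∧
    -- the limits are those whose flag and signature refine those of `β`, with `p' 0 > 0`
    (∀ (k' : ℕ) (F' : PartialFlagGeometry.PartialFlag n k')
      (β' : PartialFlagGeometry.FlagOfForms F'),
      PartialFlagGeometry.IsConjugacyLimit β.domain β.pIsom β'.domain β'.pIsom ↔
        0 < β'.p 0 ∧ PartialFlagGeometry.RefinesUpToConj β' β) := by
  exact ⟨fun _ _ h => h.exists_flagOfForms, fun _ _ _ =>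
    ⟨fun h => h.refinesUpToConj, fun h => h.2.isConjugacyLimit h.1⟩⟩
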